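/- Let $R$ be a commutative noetherian ring, let $n\ge 0$, and let $I$ be an ideal of $R[[t]][x_1,\dots,x_n]$ that is $x$-homogeneous, i.e. generated by elements that are homogeneous as polynomials in $x_1,\dots,x_n$ over $R[[t]]$. For $w\in\mathbb R_{<0}\times\mathbb R^n$ and $f=\sum_{\beta,\alpha}c_{\alpha,\beta}\,t^\beta x^\alpha\in R[[t]][x_1,\dots,x_n]$ let $\operatorname{in}_w(f)\in R[t,x_1,\dots,x_n]$ be the (finite) sum of those terms $c_{\alpha,\beta}t^\beta x^\alpha$ with $c_{\alpha,\beta}\neq 0$ for which $w\cdot(\beta,\alpha)$ is maximal (with $\operatorname{in}_w(0)=0$), and let $\operatorname{in}_w(I)=\langle \operatorname{in}_w(f)\mid f\in I\rangle$, an ideal of $R[t,x_1,\dots,x_n]$. Put $$C_w(I)=\overline{\{v\in\mathbb R_{<0}\times\mathbb R^n\mid \operatorname{in}_v(I)=\operatorname{in}_w(I)\}},\qquad C_w^0(I)=C_w(I)\cap(\{0\}\times\mathbb R^n),$$ where the closure is taken in the Euclidean topology of $\mathbb R^{n+1}$. Then the Gröbner fan $$\Sigma(I)=\{C_w(I)\mid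 w\in\mathbb R_{<0}\times\mathbb R^n\}\cup\{C_w^0(I)\mid w\in\mathbb R_{<0}\times\mathbb R^n\}$$ is a rational polyhedral fan, i.e. a finite collection of rational polyhedral cones that contains every face of each of its cones and in which the intersection of any two cones is a face of both. Its support, the union of its cones, is $\mathbb R_{\le 0}\times\mathbb R^n$. (A rational polyhedral cone is the solution set of finitely many homogeneous linear inequalities with integer coefficients; a face of a cone $C$ is a set $\{v\in C\mid u\cdot v=0\}$ with $u\in\mathbb R^{n+1}$ such that $u\cdot v\ge 0$ for all $v\in C$.) -/

import Mathlib

namespace GroebnerFan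

noncomputable section

/-- The mixed power series polynomial ring `R⟦t⟧[x₁, …, xₙ]`. -/
abbrev MixedRing (R : Type*) [CommRing R] (n : ℕ) : Type _ :=
  MvPolynomial (Fin n) (PowerSeries R)

/-- The polynomial ring `R[t, x₁, …, xₙ]`: the variable with index `0` is `t`, the variable with
index `i.succ` is the one called `i` in `MixedRing R n`. -/
abbrev PolyRing (R : Type*) [CommRing R] (n : ℕ) : Type _ :=
  MvPolynomial (Fin (n + 1)) R

variable {R : Type*} [CommRing R] {n : ℕ}

/-- The coefficient in `f` of the monomial `t ^ β * x ^ α`, where `e = (β, α)`. -/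
def termCoeff (e : Fin (n + 1) →₀ ℕ) (f : MixedRing R n) : R :=
  PowerSeries.coeff (e 0) (MvPolynomial.coeff e.tail f)

/-- The exponents `(β, α)` of the terms of `f`. -/
def termSupport (f : MixedRing R n) : Set (Fin (n + 1) →₀ ℕ) :=
  {e | termCoeff e f ≠ 0}

/-- The weight `w · (β, α)` of an exponent. -/
def weight (w : Fin (n + 1) → ℝ) (e : Fin (n + 1) →₀ ℕ) : ℝ :=
  ∑ i, w i * (e i : ℝ)

/-- The exponents of the terms of `f` of maximal weight. -/
def initialSupport (w : Fin (n + 1) → ℝ) (f : MixedRing R n) : Set (Fin (n + 1) →₀ ℕ) :=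
  {e | e ∈ termSupport f ∧ ∀ e' ∈ termSupport f, weight w e' ≤ weight w e}

/-- The initial form of `f`: the sum of its terms of maximal weight. For weights with `w 0 < 0`
the sum is finite, see `finite_initialSupport`. -/
def initialForm (w : Fin (n + 1) → ℝ) (f : MixedRing R n) : PolyRing R n :=
  ∑ᶠ e ∈ initialSupport w f, MvPolynomial.monomial e (termCoeff e f)

theorem finite_initialSupport {w : Fin (n + 1) → ℝ} (hw : w 0 < 0) (f : MixedRing R n) :
    (initialSupport w f).Finite := by
  refine Set.Finite.of_finite_image (f := Finsupp.tail)
    (f.support.finite_toSet.subset ?_) ?_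
  · rintro _ ⟨e, he, rfl⟩
    have h : termCoeff e f ≠ 0 := he.1
    simp only [Finset.mem_coe, MvPolynomial.mem_support_iff]
    intro h0
    simp [termCoeff, h0] at h
  · intro e he e' he' hee
    have hwt : weight w e = weight w e' := le_antisymm (he'.2 e he.1) (he.2 e' he'.1)
    have hs : ∀ i : Fin n, e i.succ = e' i.succ := fun i => DFunLike.congr_fun hee i
    have h0 : e 0 = e' 0 := by
      simp only [weight, Fin.sum_univ_succ, hs, add_left_inj] at hwt
      exact_mod_cast mul_left_cancel₀ hw.ne hwt
    ext i
    refine Fin.cases h0 hs i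

theorem coeff_initialForm {w : Fin (n + 1) → ℝ} (hw : w 0 < 0) (f : MixedRing R n)
    (e : Fin (n + 1) →₀ ℕ) [Decidable (e ∈ initialSupport w f)] :
    MvPolynomial.coeff e (initialForm w f) =
      if e ∈ initialSupport w f then termCoeff e f else 0 := by
  classical
  rw [initialForm, finsum_mem_eq_finite_toFinset_sum _ (finite_initialSupport hw f)]
  simp [MvPolynomial.coeff_sum, MvPolynomial.coeff_monomial]

/-- The initial ideal of `I` with respect to `w`, an ideal of `R[t, x₁, …, xₙ]`. -/
def initialIdeal (w : Fin (n + 1) → ℝ) (I : Ideal (MixedRing R n)) : Ideal (PolyRing R n) :=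
  Ideal.span {p | ∃ f ∈ I, initialForm w f = p}

/-- An ideal of `R⟦t⟧[x₁, …, xₙ]` is `x`-homogeneous if it is generated by elements that are
homogeneous as polynomials in `x₁, …, xₙ` with coefficients in `R⟦t⟧`. -/
def IsXHomogeneous (I : Ideal (MixedRing R n)) : Prop :=
  ∃ S : Set (MixedRing R n), (∀ f ∈ S, ∃ d : ℕ, f.IsHomogeneous d) ∧ I = Ideal.span S

/-- The interior Gröbner cone `C_w(I)`: the closure of the set of all weights in `ℝ_{<0} × ℝⁿ`
that have the same initial ideal as `w`. -/
def interiorCone (I : Ideal (MixedRing R n)) (w : Fin (n + 1) → ℝ) : Set (Fin (n + 1) → ℝ) :=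
  closure {v | v 0 < 0 ∧ initialIdeal v I = initialIdeal w I}

/-- The boundary Gröbner cone `C_w⁰(I) = C_w(I) ∩ ({0} × ℝⁿ)`. -/
def boundaryCone (I : Ideal (MixedRing R n)) (w : Fin (n + 1) → ℝ) : Set (Fin (n + 1) → ℝ) :=
  interiorCone I w ∩ {v | v 0 = 0}

/-- The Gröbner fan `Σ(I)`: all interior and all boundary Gröbner cones. -/
def groebnerFan (I : Ideal (MixedRing R n)) : Set (Set (Fin (n + 1) → ℝ)) :=
  {C | ∃ w : Fin (n + 1) → ℝ, w 0 < 0 ∧ C = interiorCone I w} ∪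
    {C | ∃ w : Fin (n + 1) → ℝ, w 0 < 0 ∧ C = boundaryCone I w}

end

/-- A rational polyhedral cone in `ℝᵐ`: the solution set of finitely many homogeneous linear
inequalities with integral coefficients. -/
def IsRationalPolyhedralCone {m : ℕ} (C : Set (Fin m → ℝ)) : Prop :=
  ∃ A : Finset (Fin m → ℤ), C = {v | ∀ a ∈ A, 0 ≤ ∑ i, (a i : ℝ) * v i}

/-- `F` is a face of the cone `C`: it is cut out of `C` by a supporting hyperplane `u · v = 0`.
The choice `u = 0` makes `C` a face of itself. -/
def IsFace {m : ℕ} (F C : Set (Fin m → ℝ)) : Prop :=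
  ∃ u : Fin m → ℝ, (∀ v ∈ C, 0 ≤ ∑ i, u i * v i) ∧ F = {v | v ∈ C ∧ ∑ i, u i * v i = 0}

/-- A rational polyhedral fan: a finite collection of rational polyhedral cones that contains all
faces of its cones and in which any two cones intersect in a common face. -/
structure IsRationalPolyhedralFan {m : ℕ} (S : Set (Set (Fin m → ℝ))) : Prop where
  finite : S.Finite
  isCone : ∀ C ∈ S, IsRationalPolyhedralCone C
  face_mem : ∀ C ∈ S, ∀ F, IsFace F C → F ∈ S
  inter_isFace : ∀ C ∈ S, ∀ D ∈ S, IsFace (C ∩ D) C ∧ IsFace (C ∩ D) D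

end GroebnerFan

namespace GroebnerFan

open Finset

variable {R : Type*} [CommRing R] {n : ℕ}

/-! ### Coefficients of elements of the mixed ring -/

/-! Refine a weight `w` with `w 0 < 0` by a fixed tie-breaking order on exponents. High powers of
`t` have low weight, so only finitely many exponents of given `x`-degree lie above a given one.
Hence `x`-homogeneous elements can be divided with remainder by recursion from large exponents to
small, with quotients that are power series in `t` (`exists_reduction`). As `R[t, x]` is noetherian,
`I` has a finite reduced basis `g i` with leading exponents `m i`; since `R` is only a ring, leading
terms keep their coefficients throughout.

Consider the cone of weights `v` for which every `m i` keeps maximal weight in `g i`. For `v 0 < 0`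
in it, the `g i` are still a reduced basis (`IsReducedBasis.of_isLead`), their initial forms
generate the initial ideal, and another weight has the same initial ideal exactly if it gives every
`g i` the same initial support (`IsReducedBasis.initialIdeal_eq_iff`). So the class of `v` is cut
out by prescribing which of finitely many integral functionals vanish and which are positive: it is
the relative interior of a face, and its closure is that face (`IsReducedBasis.class_eq`,
`closure_relative_interior`). Only finitely many leading ideals occur (`finite_leadIdeals`), so
finitely many such cones cover the open half space.

The rest is convex geometry (`isRationalPolyhedralFan_of_cover`). The smallest faces of two cones at
a common point agree: in the open half space both are the closure of the class of the point, and on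
the boundary a connectedness argument replaces the missing class (`faceAt_eq_faceAt`). Every face
inside the boundary is the boundary part of a face meeting the open half space
(`exists_faceAt_inter_eq`). -/

@[simp] theorem termCoeff_zero (e : Fin (n + 1) →₀ ℕ) : termCoeff e (0 : MixedRing R n) = 0 := by
  simp [termCoeff]

@[simp] theorem termCoeff_add (e : Fin (n + 1) →₀ ℕ) (f g : MixedRing R n) :
    termCoeff e (f + g) = termCoeff e f + termCoeff e g := by
  simp [termCoeff]

@[simp] theorem termCoeff_sub (e : Fin (n + 1) →₀ ℕ) (f g : MixedRing R n) :
    termCoeff e (f - g) = termCoeff e f - termCoeff e g := by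
  simp [termCoeff]

theorem termCoeff_sum {ι : Type*} (s : Finset ι) (e : Fin (n + 1) →₀ ℕ) (f : ι → MixedRing R n) :
    termCoeff e (∑ i ∈ s, f i) = ∑ i ∈ s, termCoeff e (f i) := by
  simp [termCoeff, MvPolynomial.coeff_sum]

theorem ext_termCoeff {f g : MixedRing R n} (h : ∀ e, termCoeff e f = termCoeff e g) : f = g := by
  refine MvPolynomial.ext _ _ fun α => PowerSeries.ext fun β => ?_
  simpa [termCoeff] using h (Finsupp.cons β α)

theorem tail_add (e e' : Fin (n + 1) →₀ ℕ) : (e + e').tail = e.tail + e'.tail := by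
  ext; simp [Finsupp.tail_apply]

theorem termCoeff_mul (e : Fin (n + 1) →₀ ℕ) (f g : MixedRing R n) :
    termCoeff e (f * g) = ∑ p ∈ antidiagonal e, termCoeff p.1 f * termCoeff p.2 g := by
  simp only [termCoeff, MvPolynomial.coeff_mul, map_sum, PowerSeries.coeff_mul]
  rw [Finset.sum_sigma']
  symm
  refine Finset.sum_bij' (fun p _ => ⟨(p.1.tail, p.2.tail), (p.1 0, p.2 0)⟩)
    (fun q _ => (Finsupp.cons q.2.1 q.1.1, Finsupp.cons q.2.2 q.1.2)) ?_ ?_ ?_ ?_ ?_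
  · intro p hp
    rw [HasAntidiagonal.mem_antidiagonal] at hp
    simp [← hp, tail_add]
  · rintro ⟨⟨a, b⟩, ⟨c, d⟩⟩ hq
    simp only [mem_sigma, HasAntidiagonal.mem_antidiagonal] at hq ⊢
    rw [← Finsupp.cons_tail e, ← hq.1, ← hq.2]
    ext i
    refine Fin.cases ?_ (fun i => ?_) i <;> simp
  · intro p _
    simp
  · rintro ⟨⟨a, b⟩, ⟨c, d⟩⟩ _
    simp
  · intro p _
    rfl

theorem mem_termSupport {e : Fin (n + 1) →₀ ℕ} {f : MixedRing R n} :
    e ∈ termSupport f ↔ termCoeff e f ≠ 0 := Iff.rfl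

theorem finite_tail_termSupport (f : MixedRing R n) :
    (Finsupp.tail '' termSupport f).Finite := by
  refine f.support.finite_toSet.subset ?_
  rintro _ ⟨e, he, rfl⟩
  simp only [mem_coe, MvPolynomial.mem_support_iff]
  intro h0
  exact he (by simp [termCoeff, h0])

theorem termSupport_nonempty {f : MixedRing R n} (hf : f ≠ 0) : (termSupport f).Nonempty := by
  by_contra h
  rw [Set.not_nonempty_iff_eq_empty] at h
  refine hf (ext_termCoeff fun e => ?_)
  by_contra he
  have : e ∈ termSupport f := he
  simp [h] at this

/-- Only the monomials in `x` must be finite in number; the coefficients along powers of `t` are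
unrestricted. This lets infinite divisions produce their quotients without any limit process. -/
theorem exists_termCoeff_eq {T : Set (Fin n →₀ ℕ)} (hT : T.Finite)
    (c : (Fin (n + 1) →₀ ℕ) → R) (hc : ∀ e, c e ≠ 0 → e.tail ∈ T) :
    ∃ f : MixedRing R n, ∀ e, termCoeff e f = c e := by
  classical
  refine ⟨∑ α ∈ hT.toFinset, MvPolynomial.monomial α
    (PowerSeries.mk fun β => c (Finsupp.cons β α)), fun e => ?_⟩
  simp only [termCoeff, MvPolynomial.coeff_sum, MvPolynomial.coeff_monomial, map_sum]
  by_cases h : e.tail ∈ T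
  · rw [Finset.sum_eq_single e.tail] <;> simp +contextual [h]
  · rw [Finset.sum_eq_zero]
    · by_contra h'
      exact h (hc e (Ne.symm h'))
    · intro α hα
      rw [if_neg, map_zero]
      rintro rfl
      exact h (by simpa using hα)

/-- The term `a * t ^ β * x ^ α`, where `e = (β, α)`. -/
noncomputable def mixedTerm (e : Fin (n + 1) →₀ ℕ) (a : R) : MixedRing R n :=
  MvPolynomial.monomial e.tail (PowerSeries.monomial (e 0) a)

theorem termCoeff_mixedTerm (e e' : Fin (n + 1) →₀ ℕ) (a : R) :
    termCoeff e' (mixedTerm e a) = if e' = e then a else 0 := by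
  classical
  have key : e' = e ↔ e.tail = e'.tail ∧ e' 0 = e 0 := by
    constructor
    · rintro rfl; simp
    · rintro ⟨h1, h2⟩
      rw [← Finsupp.cons_tail e', ← Finsupp.cons_tail e, h1, h2]
  simp only [termCoeff, mixedTerm, MvPolynomial.coeff_monomial, key]
  by_cases h : e.tail = e'.tail
  · simp [h, PowerSeries.coeff_monomial]
  · simp [h]

theorem termCoeff_mixedTerm_mul (e e' : Fin (n + 1) →₀ ℕ) (a : R) (f : MixedRing R n) :
    termCoeff e' (mixedTerm e a * f) = if e ≤ e' then a * termCoeff (e' - e) f else 0 := by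
  classical
  rw [termCoeff_mul]
  split_ifs with h
  · rw [Finset.sum_eq_single (e, e' - e)]
    · simp [termCoeff_mixedTerm]
    · rintro ⟨p, q⟩ hp hne
      rw [HasAntidiagonal.mem_antidiagonal] at hp
      rw [termCoeff_mixedTerm, if_neg, zero_mul]
      rintro rfl
      exact hne (by simp [← hp])
    · simp [h]
  · refine Finset.sum_eq_zero ?_
    rintro ⟨p, q⟩ hp
    rw [HasAntidiagonal.mem_antidiagonal] at hp
    rw [termCoeff_mixedTerm, if_neg, zero_mul]
    rintro rfl
    exact h (by simp [← hp])

/-! ### Weights and orders on exponents -/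

theorem weight_add (w : Fin (n + 1) → ℝ) (e e' : Fin (n + 1) →₀ ℕ) :
    weight w (e + e') = weight w e + weight w e' := by
  simp [weight, mul_add, Finset.sum_add_distrib]

/-- The degree in `x` of the monomial with exponent `e`. -/
noncomputable def xDegree (e : Fin (n + 1) →₀ ℕ) : ℕ := e.tail.degree

theorem xDegree_add (e e' : Fin (n + 1) →₀ ℕ) : xDegree (e + e') = xDegree e + xDegree e' := by
  simp [xDegree, tail_add]

/-- All terms of `f` have degree `d` in `x`. -/
def IsXForm (d : ℕ) (f : MixedRing R n) : Prop := ∀ e ∈ termSupport f, xDegree e = d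

theorem finite_tail_degree (d : ℕ) : {α : Fin n →₀ ℕ | α.degree = d}.Finite := by
  refine ((univ : Finset (Fin n)).finsuppAntidiag d).finite_toSet.subset ?_
  intro α hα
  simp only [Set.mem_ofPred_eq, Finsupp.degree_eq_sum] at hα
  simp [Finset.mem_finsuppAntidiag, hα]

/-- For each of the finitely many monomials in `x`, a lower bound on the weight bounds the power of
`t` from above, because `w 0 < 0`. -/
theorem finite_weight_ge {w : Fin (n + 1) → ℝ} (hw : w 0 < 0) {T : Set (Fin n →₀ ℕ)}
    (hT : T.Finite) (c : ℝ) : {e : Fin (n + 1) →₀ ℕ | e.tail ∈ T ∧ c ≤ weight w e}.Finite := by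
  obtain ⟨B, hB⟩ : ∃ B : ℕ, ∀ α ∈ T, ((∑ i, w i.succ * (α i : ℝ)) - c) / (-w 0) ≤ B := by
    have := (hT.image fun α : Fin n →₀ ℕ => ((∑ i, w i.succ * (α i : ℝ)) - c) / (-w 0)).bddAbove
    obtain ⟨b, hb⟩ := this
    obtain ⟨B, hB⟩ := exists_nat_ge b
    exact ⟨B, fun α hα => (hb ⟨α, hα, rfl⟩).trans hB⟩
  refine ((hT.prod (Set.finite_le_nat B)).image
    fun p : (Fin n →₀ ℕ) × ℕ => Finsupp.cons p.2 p.1).subset ?_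
  rintro e ⟨he, hc⟩
  refine ⟨(e.tail, e 0), ⟨he, ?_⟩, by simp⟩
  have h1 := hB _ he
  rw [div_le_iff₀ (by linarith)] at h1
  simp only [weight, Fin.sum_univ_succ] at hc
  simp only [Finsupp.tail_apply] at h1
  have h2 : -w 0 * (e 0 : ℝ) ≤ -w 0 * B := by linarith
  exact_mod_cast le_of_mul_le_mul_left h2 (by linarith)

section Order

variable {Γ : Type*} [AddCommMonoid Γ] [LinearOrder Γ]

/-- The order on exponents given by `κ` compares weights with respect to `w` first. -/
def Refines (κ : (Fin (n + 1) →₀ ℕ) →+ Γ) (w : Fin (n + 1) → ℝ) : Prop :=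
  Function.Injective κ ∧ ∀ e e', weight w e < weight w e' → κ e < κ e'

theorem Refines.weight_le {κ : (Fin (n + 1) →₀ ℕ) →+ Γ} {w : Fin (n + 1) → ℝ} (h : Refines κ w)
    {e e' : Fin (n + 1) →₀ ℕ} (hle : κ e ≤ κ e') : weight w e ≤ weight w e' := by
  by_contra! hlt
  exact absurd (h.2 _ _ hlt) (not_lt.2 hle)

/-- The order on exponents that compares weights first and breaks ties with `κ`. -/
noncomputable def weightOrder (w : Fin (n + 1) → ℝ) (κ : (Fin (n + 1) →₀ ℕ) →+ Γ) :
    (Fin (n + 1) →₀ ℕ) →+ ℝ ×ₗ Γ where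
  toFun e := toLex (weight w e, κ e)
  map_zero' := by simp [weight]
  map_add' e e' := by rw [weight_add, map_add]; rfl

omit [LinearOrder Γ] in
theorem weightOrder_apply (w : Fin (n + 1) → ℝ) (κ : (Fin (n + 1) →₀ ℕ) →+ Γ) (e : Fin (n + 1) →₀ ℕ) :
    weightOrder w κ e = toLex (weight w e, κ e) := rfl

theorem weightOrder_le {w : Fin (n + 1) → ℝ} {κ : (Fin (n + 1) →₀ ℕ) →+ Γ} {e e' : Fin (n + 1) →₀ ℕ} :
    weightOrder w κ e ≤ weightOrder w κ e' ↔
      weight w e < weight w e' ∨ weight w e = weight w e' ∧ κ e ≤ κ e' := by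
  simp [weightOrder_apply, Prod.Lex.le_iff]

theorem refines_weightOrder (w : Fin (n + 1) → ℝ) {κ : (Fin (n + 1) →₀ ℕ) →+ Γ}
    (hκ : Function.Injective κ) : Refines (weightOrder w κ) w := by
  refine ⟨fun e e' h => hκ ?_, fun e e' h => ?_⟩
  · have := congrArg (fun x => (ofLex x).2) h
    simpa [weightOrder_apply] using this
  · simp [weightOrder_apply, Prod.Lex.lt_iff, h]

/-- The lexicographic order on exponents. -/
noncomputable def lexOrder (n : ℕ) : (Fin (n + 1) →₀ ℕ) →+ Lex (Fin (n + 1) →₀ ℕ) where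
  toFun e := toLex e
  map_zero' := rfl
  map_add' _ _ := rfl

theorem lexOrder_injective (n : ℕ) : Function.Injective (lexOrder n) := fun _ _ h => h

/-- `m` is the exponent of the leading term of `f` with respect to the order given by `κ`. -/
def IsLead (κ : (Fin (n + 1) →₀ ℕ) →+ Γ) (f : MixedRing R n) (m : Fin (n + 1) →₀ ℕ) : Prop :=
  m ∈ termSupport f ∧ ∀ e ∈ termSupport f, κ e ≤ κ m

/-- The order need not be a well-order in either direction; the maximum exists because only finitely
many exponents of `f` have at least the weight of a given one. -/
theorem exists_isLead {κ : (Fin (n + 1) →₀ ℕ) →+ Γ} {w : Fin (n + 1) → ℝ} (hw : w 0 < 0)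
    (hκ : Refines κ w) {f : MixedRing R n} (hf : f ≠ 0) : ∃ m, IsLead κ f m := by
  obtain ⟨e₀, he₀⟩ := termSupport_nonempty hf
  have hfin : {e | e ∈ termSupport f ∧ weight w e₀ ≤ weight w e}.Finite :=
    (finite_weight_ge hw (finite_tail_termSupport f) (weight w e₀)).subset
      fun e he => ⟨⟨e, he.1, rfl⟩, he.2⟩
  obtain ⟨m, hm, hmax⟩ := Set.exists_max_image _ κ hfin ⟨e₀, he₀, le_rfl⟩
  refine ⟨m, hm.1, fun e he => ?_⟩
  by_cases h : weight w e₀ ≤ weight w e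
  · exact hmax e ⟨he, h⟩
  · exact (hκ.2 _ _ ((not_le.1 h).trans_le hm.2)).le

/-- This licenses recursion from larger exponents to smaller ones. Fixing the `x`-degree is
essential: it leaves finitely many monomials in `x`. -/
theorem wellFounded_xDegree {κ : (Fin (n + 1) →₀ ℕ) →+ Γ} {w : Fin (n + 1) → ℝ} (hw : w 0 < 0)
    (hκ : Refines κ w) (d : ℕ) : WellFounded fun e' e : Fin (n + 1) →₀ ℕ =>
      xDegree e' = d ∧ κ e < κ e' := by
  rw [WellFounded.wellFounded_iff_has_min]
  rintro S ⟨e₀, he₀⟩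
  have hfin : {e | e ∈ S ∧ xDegree e = d ∧ weight w e₀ ≤ weight w e}.Finite :=
    (finite_weight_ge hw (finite_tail_degree d) (weight w e₀)).subset fun e he => he.2
  by_cases hne : {e | e ∈ S ∧ xDegree e = d ∧ κ e₀ < κ e}.Nonempty
  · obtain ⟨m, hm, hmax⟩ := Set.exists_max_image _ κ (hfin.subset
      fun e he => ⟨he.1, he.2.1, hκ.weight_le he.2.2.le⟩) hne
    refine ⟨m, hm.1, fun e he h => ?_⟩
    exact absurd h.2 (not_lt.2 (hmax e ⟨he, h.1, hm.2.2.trans h.2⟩))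
  · exact ⟨e₀, he₀, fun e he h => hne ⟨e, he, h⟩⟩

end Order

end GroebnerFan

namespace GroebnerFan

open Finset

variable {R : Type*} [CommRing R] {n : ℕ}
variable {Γ : Type*} [AddCommMonoid Γ] [LinearOrder Γ]

/-! ### Reduction -/

/-- The ideal generated by the terms of the `g i` with exponents `m i`. -/
noncomputable def termIdeal {ι : Type*} (g : ι → MixedRing R n) (m : ι → Fin (n + 1) →₀ ℕ) :
    Ideal (PolyRing R n) :=
  Ideal.span (Set.range fun i => MvPolynomial.monomial (m i) (termCoeff (m i) (g i)))

theorem exists_coeff_of_mem_termIdeal {ι : Type*} [Fintype ι] {g : ι → MixedRing R n}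
    {m : ι → Fin (n + 1) →₀ ℕ} {p : PolyRing R n} (hp : p ∈ termIdeal g m)
    (e : Fin (n + 1) →₀ ℕ) : ∃ a : ι → R, (∀ i, ¬ m i ≤ e → a i = 0) ∧
      p.coeff e = ∑ i, a i * termCoeff (m i) (g i) := by
  classical
  rw [termIdeal, Ideal.mem_span_range_iff_exists_fun] at hp
  obtain ⟨q, rfl⟩ := hp
  refine ⟨fun i => if m i ≤ e then (q i).coeff (e - m i) else 0, fun i hi => if_neg hi, ?_⟩
  rw [MvPolynomial.coeff_sum]
  refine Finset.sum_congr rfl fun i _ => ?_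
  rw [MvPolynomial.coeff_mul_monomial']
  by_cases h : m i ≤ e <;> simp [h]

/-- Reduction of `f` modulo finitely many `x`-homogeneous elements `g i` with leading exponents
`m i`: the remainder has no term in the ideal generated by the leading terms. -/
theorem exists_reduction [IsOrderedCancelAddMonoid Γ] {κ : (Fin (n + 1) →₀ ℕ) →+ Γ}
    {w : Fin (n + 1) → ℝ}
    (hw : w 0 < 0) (hκ : Refines κ w) {ι : Type*} [Fintype ι] {g : ι → MixedRing R n}
    {m : ι → Fin (n + 1) →₀ ℕ} (hg : ∀ i, IsXForm (xDegree (m i)) (g i))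
    (hm : ∀ i, IsLead κ (g i) (m i)) {d : ℕ} {f : MixedRing R n} (hf : IsXForm d f) :
    ∃ (q : ι → MixedRing R n) (r : MixedRing R n), f = ∑ i, q i * g i + r ∧ IsXForm d r ∧
      (∀ e ∈ termSupport r, MvPolynomial.monomial e (termCoeff e r) ∉ termIdeal g m) ∧
      (∀ i, ∀ e ∈ termSupport (q i), ∃ e' ∈ termSupport f, κ (e + m i) ≤ κ e') ∧
      ∀ e ∈ termSupport r, ∃ e' ∈ termSupport f, κ e ≤ κ e' := by
  classical
  have hwf := wellFounded_xDegree hw hκ d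
  -- `B e a` is the coefficient of the exponent `e` before the reduction step at `e`
  let B : (Fin (n + 1) →₀ ℕ) → ((Fin (n + 1) →₀ ℕ) → ι → R) → R := fun e a =>
    termCoeff e f - ∑ i, ∑ p ∈ antidiagonal e,
      if p.2 = m i then 0 else a (p.1 + m i) i * termCoeff p.2 (g i)
  -- One division step: a term in the term ideal is cancelled completely, any other is left to the
  -- remainder. Choosing `c = 0` for `b = 0` keeps the supports of the quotients under control.
  have hF : ∀ (e : Fin (n + 1) →₀ ℕ) (b : R), ∃ c : ι → R,
      (∀ i, ¬ m i ≤ e → c i = 0) ∧ (b = 0 → c = 0) ∧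
      (MvPolynomial.monomial e b ∈ termIdeal g m → b = ∑ i, c i * termCoeff (m i) (g i)) ∧
      (MvPolynomial.monomial e b ∉ termIdeal g m → c = 0) := by
    intro e b
    by_cases hb : b = 0
    · exact ⟨0, by simp [hb]⟩
    by_cases h : MvPolynomial.monomial e b ∈ termIdeal g m
    · obtain ⟨c, hc, hbc⟩ := exists_coeff_of_mem_termIdeal h e
      exact ⟨c, hc, fun h' => absurd h' hb, fun _ => by simpa using hbc, fun h' => absurd h h'⟩
    · exact ⟨0, by simp [h]⟩
  choose F hF1 hF2 hF3 hF4 using hF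
  -- The number `a e i` will be the coefficient of `q i` at `e - m i`; it depends only on those at
  -- exponents above `e`.
  let a : (Fin (n + 1) →₀ ℕ) → ι → R := hwf.fix fun e rec =>
    F e (B e fun e' => if h : xDegree e' = d ∧ κ e < κ e' then rec e' h else 0)
  let a' : (Fin (n + 1) →₀ ℕ) → (Fin (n + 1) →₀ ℕ) → ι → R := fun e e' =>
    if xDegree e' = d ∧ κ e < κ e' then a e' else 0
  have ha : ∀ e, a e = F e (B e (a' e)) := fun e => by
    simp only [a]
    rw [hwf.fix_eq]
    rfl
  -- A nonzero coefficient met during the division is inherited from a larger exponent, ultimately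
  -- from a term of `f`.
  have hB : ∀ e, B e (a' e) ≠ 0 → ∃ e' ∈ termSupport f, κ e ≤ κ e' := by
    intro e
    induction e using hwf.induction with
    | _ e ih =>
    intro he
    by_cases hfe : e ∈ termSupport f
    · exact ⟨e, hfe, le_rfl⟩
    · have : ∃ e', (xDegree e' = d ∧ κ e < κ e') ∧ a e' ≠ 0 := by
        by_contra! hcon
        refine he ?_
        have h0 : a' e = 0 := by
          funext e'
          simp only [a']
          split_ifs with h
          · exact hcon e' h
          · rfl
        simp only [B, h0]
        rw [mem_termSupport, not_not] at hfe
        simp [hfe]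
      obtain ⟨e', h1, h2⟩ := this
      have h3 : B e' (a' e') ≠ 0 := fun h => h2 (by rw [ha, hF2 _ _ h])
      obtain ⟨e'', h4, h5⟩ := ih e' h1 h3
      exact ⟨e'', h4, h1.2.le.trans h5⟩
  have hq : ∀ i, ∃ q : MixedRing R n, ∀ e, termCoeff e q =
      if xDegree (e + m i) = d then a (e + m i) i else 0 := by
    intro i
    refine exists_termCoeff_eq (T := ⋃ k ∈ Set.Iic d, {α : Fin n →₀ ℕ | α.degree = k})
      ((Set.finite_Iic d).biUnion fun k _ => finite_tail_degree k) _ fun e he => ?_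
    have : xDegree (e + m i) = d := by
      by_contra h
      exact he (if_neg h)
    rw [xDegree_add] at this
    simp only [Set.mem_iUnion]
    exact ⟨e.tail.degree, by simp only [xDegree] at this; simp only [Set.mem_Iic]; omega, rfl⟩
  choose q hq using hq
  -- The leading term of `g i` gives the new contribution at `e`. Every other term has a smaller
  -- exponent, so it meets a coefficient of `q i` already fixed at an exponent above `e`.
  have hprod : ∀ i e, termCoeff e (q i * g i) = if xDegree e = d then
      (∑ p ∈ antidiagonal e, if p.2 = m i then 0 else a' e (p.1 + m i) i * termCoeff p.2 (g i)) +
        a e i * termCoeff (m i) (g i) else 0 := by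
    intro i e
    rw [termCoeff_mul]
    have hlast : ∀ x : R, (∑ p ∈ antidiagonal e, if p.2 = m i then x else 0) =
        if m i ≤ e then x else 0 := by
      intro x
      split_ifs with h
      · rw [Finset.sum_eq_single (e - m i, m i)]
        · simp
        · rintro ⟨p1, p2⟩ hp hne
          rw [HasAntidiagonal.mem_antidiagonal] at hp
          refine if_neg ?_
          rintro rfl
          exact hne (by simp [← hp])
        · simp [tsub_add_cancel_of_le h]
      · refine Finset.sum_eq_zero ?_
        rintro ⟨p1, p2⟩ hp
        rw [HasAntidiagonal.mem_antidiagonal] at hp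
        refine if_neg ?_
        rintro rfl
        exact h (by simp [← hp])
    have hcoef : a e i * termCoeff (m i) (g i) =
        if m i ≤ e then a e i * termCoeff (m i) (g i) else 0 := by
      split_ifs with h
      · rfl
      · rw [ha, hF1 _ _ _ h, zero_mul]
    rw [hcoef, ← hlast, ← Finset.sum_add_distrib]
    have hzero : ∀ p ∈ antidiagonal e, termCoeff p.2 (g i) ≠ 0 →
        xDegree (p.1 + m i) = xDegree e := by
      rintro ⟨p1, p2⟩ hp h
      rw [HasAntidiagonal.mem_antidiagonal] at hp
      simp only at hp h ⊢
      rw [← hp, xDegree_add, xDegree_add, hg i _ h]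
    split_ifs with hd
    · refine Finset.sum_congr rfl ?_
      rintro ⟨p1, p2⟩ hp
      have hz := hzero _ hp
      rw [HasAntidiagonal.mem_antidiagonal] at hp
      simp only at hp hz ⊢
      rw [hq]
      by_cases h2 : p2 = m i
      · subst h2
        simp [hp, hd]
      · rw [if_neg h2, if_neg h2, add_zero]
        by_cases h3 : termCoeff p2 (g i) = 0
        · simp [h3]
        · have hdeg : xDegree (p1 + m i) = d := (hz h3).trans hd
          have hlt : κ e < κ (p1 + m i) := by
            rw [← hp, map_add, map_add]
            refine add_lt_add_right (lt_of_le_of_ne ((hm i).2 p2 h3) fun h => h2 (hκ.1 h)) _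
          rw [if_pos hdeg]
          simp only [a']
          rw [if_pos ⟨hdeg, hlt⟩]
    · refine Finset.sum_eq_zero fun p hp => ?_
      by_cases h3 : termCoeff p.2 (g i) = 0
      · simp [h3]
      · rw [hq, if_neg, zero_mul]
        rw [hzero p hp h3]
        exact hd
  have hr : ∀ e, termCoeff e (f - ∑ i, q i * g i) = if xDegree e = d then
      B e (a' e) - ∑ i, a e i * termCoeff (m i) (g i) else 0 := by
    intro e
    rw [termCoeff_sub, termCoeff_sum]
    simp only [hprod]
    split_ifs with hd
    · rw [Finset.sum_add_distrib, ← sub_sub]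
    · simp only [Finset.sum_const_zero, sub_zero]
      by_contra h
      exact hd (hf e h)
  have hr' : ∀ e, termCoeff e (f - ∑ i, q i * g i) = 0 ∨ xDegree e = d ∧
      termCoeff e (f - ∑ i, q i * g i) = B e (a' e) ∧
      MvPolynomial.monomial e (B e (a' e)) ∉ termIdeal g m := by
    intro e
    rw [hr]
    split_ifs with hd
    · by_cases h : MvPolynomial.monomial e (B e (a' e)) ∈ termIdeal g m
      · left
        rw [ha, ← hF3 _ _ h, sub_self]
      · right
        rw [ha, hF4 _ _ h]
        simp [hd, h]
    · exact Or.inl rfl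
  refine ⟨q, f - ∑ i, q i * g i, by ring, ?_, ?_, ?_, ?_⟩
  · intro e he
    exact ((hr' e).resolve_left he).1
  · intro e he
    obtain ⟨-, h1, h2⟩ := (hr' e).resolve_left he
    rwa [h1]
  · intro i e he
    rw [mem_termSupport, hq] at he
    refine hB _ fun h0 => he ?_
    rw [ha, hF2 _ _ h0]
    simp
  · intro e he
    obtain ⟨-, h1, h2⟩ := (hr' e).resolve_left he
    refine hB _ ?_
    rw [← h1]
    exact he

/-- Reduction of the tail of an `x`-homogeneous element with respect to its leading exponents. -/
theorem exists_tail_reduction [IsOrderedCancelAddMonoid Γ] {κ : (Fin (n + 1) →₀ ℕ) →+ Γ}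
    {w : Fin (n + 1) → ℝ}
    (hw : w 0 < 0) (hκ : Refines κ w) {ι : Type*} [Fintype ι] {g : ι → MixedRing R n}
    {m : ι → Fin (n + 1) →₀ ℕ} (hg : ∀ i, IsXForm (xDegree (m i)) (g i))
    (hm : ∀ i, IsLead κ (g i) (m i)) {I : Ideal (MixedRing R n)} (hgI : ∀ i, g i ∈ I)
    {d : ℕ} {f : MixedRing R n} (hf : IsXForm d f)
    (hfI : f ∈ I) {s : Fin (n + 1) →₀ ℕ} (hs : IsLead κ f s) :
    ∃ r ∈ I, IsXForm d r ∧ IsLead κ r s ∧ termCoeff s r = termCoeff s f ∧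
      ∀ e ∈ termSupport r, e ≠ s →
        MvPolynomial.monomial e (termCoeff e r) ∉ termIdeal g m := by
  -- The leading term is split off before the division, so that it survives even if it lies in the
  -- term ideal.
  set τ := mixedTerm s (termCoeff s f) with hτ
  have hτc : ∀ e, termCoeff e (f - τ) = if e = s then 0 else termCoeff e f := by
    intro e
    rw [termCoeff_sub, hτ, termCoeff_mixedTerm]
    split_ifs with h
    · rw [h, sub_self]
    · rw [sub_zero]
  have hsub : ∀ e ∈ termSupport (f - τ), e ≠ s ∧ e ∈ termSupport f := by
    intro e he
    rw [mem_termSupport, hτc] at he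
    split_ifs at he with h
    · exact absurd rfl he
    · exact ⟨h, he⟩
  obtain ⟨q, r, hfr, hrd, hrJ, -, hrκ⟩ :=
    exists_reduction hw hκ hg hm (f := f - τ) (d := d) fun e he => hf e (hsub e he).2
  have hlt : ∀ e ∈ termSupport r, κ e < κ s := by
    intro e he
    obtain ⟨e', he', hle⟩ := hrκ e he
    have := hsub e' he'
    exact hle.trans_lt (lt_of_le_of_ne (hs.2 _ this.2) fun h => this.1 (hκ.1 h))
  have hsr : termCoeff s r = 0 := by
    by_contra h
    exact (hlt s h).ne rfl
  have hc : ∀ e, termCoeff e (τ + r) = if e = s then termCoeff s f else termCoeff e r := by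
    intro e
    rw [termCoeff_add, hτ, termCoeff_mixedTerm]
    split_ifs with h
    · rw [h, hsr, add_zero]
    · rw [zero_add]
  have hmem : ∀ e ∈ termSupport (τ + r), e = s ∨ e ∈ termSupport r := by
    intro e he
    rw [mem_termSupport, hc] at he
    split_ifs at he with h
    · exact Or.inl h
    · exact Or.inr he
  refine ⟨τ + r, ?_, ?_, ⟨?_, ?_⟩, ?_, ?_⟩
  · have : τ + r = f - ∑ i, q i * g i := by linear_combination -hfr
    rw [this]
    exact I.sub_mem hfI (I.sum_mem fun i _ => I.mul_mem_left _ (hgI i))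
  · intro e he
    rcases hmem e he with rfl | h
    · exact hf _ hs.1
    · exact hrd e h
  · rw [mem_termSupport, hc, if_pos rfl]
    exact hs.1
  · intro e he
    rcases hmem e he with rfl | h
    · exact le_rfl
    · exact (hlt e h).le
  · rw [hc, if_pos rfl]
  · intro e he hes
    have := hrJ e ((hmem e he).resolve_left hes)
    rwa [hc, if_neg hes]

end GroebnerFan

namespace GroebnerFan

open Finset

variable {R : Type*} [CommRing R] {n : ℕ}
variable {Γ : Type*} [AddCommMonoid Γ] [LinearOrder Γ]

/-! ### Reduced bases -/

/-- The ideal `I` contains the homogeneous components in `x` of its elements. -/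
def HasXComponents (I : Ideal (MixedRing R n)) : Prop :=
  ∀ f ∈ I, ∀ d, MvPolynomial.homogeneousComponent d f ∈ I

theorem IsXHomogeneous.hasXComponents {I : Ideal (MixedRing R n)} (hI : IsXHomogeneous I) :
    HasXComponents I := by
  obtain ⟨S, hS, rfl⟩ := hI
  let _ := MvPolynomial.gradedAlgebra (σ := Fin n) (R := PowerSeries R)
  have hh : (Ideal.span S).IsHomogeneous
      (MvPolynomial.homogeneousSubmodule (Fin n) (PowerSeries R)) :=
    Ideal.homogeneous_span _ _ fun f hf => hS f hf
  intro f hf d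
  exact MvPolynomial.homogeneousComponent_mem_of_mem hh hf d

theorem termCoeff_homogeneousComponent (d : ℕ) (f : MixedRing R n) (e : Fin (n + 1) →₀ ℕ) :
    termCoeff e (MvPolynomial.homogeneousComponent d f) =
      if xDegree e = d then termCoeff e f else 0 := by
  rw [termCoeff, MvPolynomial.coeff_homogeneousComponent]
  unfold xDegree
  split_ifs <;> simp [termCoeff]

theorem mem_termSupport_homogeneousComponent {d : ℕ} {f : MixedRing R n}
    {e : Fin (n + 1) →₀ ℕ} :
    e ∈ termSupport (MvPolynomial.homogeneousComponent d f) ↔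
      xDegree e = d ∧ e ∈ termSupport f := by
  rw [mem_termSupport, termCoeff_homogeneousComponent, mem_termSupport]
  split_ifs with h <;> simp [h]

/-- The ideal generated by the leading terms of the `x`-homogeneous elements of `I`. -/
noncomputable def leadIdeal (κ : (Fin (n + 1) →₀ ℕ) →+ Γ) (I : Ideal (MixedRing R n)) :
    Ideal (PolyRing R n) :=
  Ideal.span {p | ∃ f ∈ I, ∃ m, IsXForm (xDegree m) f ∧ IsLead κ f m ∧
    MvPolynomial.monomial m (termCoeff m f) = p}

theorem monomial_mem_leadIdeal {κ : (Fin (n + 1) →₀ ℕ) →+ Γ} {I : Ideal (MixedRing R n)}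
    (hI : HasXComponents I) {f : MixedRing R n} (hf : f ∈ I) {m : Fin (n + 1) →₀ ℕ}
    (hm : IsLead κ f m) : MvPolynomial.monomial m (termCoeff m f) ∈ leadIdeal κ I := by
  refine Ideal.subset_span ⟨_, hI f hf (xDegree m), m, ?_, ⟨?_, ?_⟩, ?_⟩
  · exact fun e he => (mem_termSupport_homogeneousComponent.1 he).1
  · exact mem_termSupport_homogeneousComponent.2 ⟨rfl, hm.1⟩
  · exact fun e he => hm.2 e (mem_termSupport_homogeneousComponent.1 he).2
  · rw [termCoeff_homogeneousComponent, if_pos rfl]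

/-- A nonzero element of `I` would have a leading term, which lies in the leading ideal. This shows
that remainders of elements of `I` vanish. -/
theorem eq_zero_of_forall_notMem_leadIdeal {κ : (Fin (n + 1) →₀ ℕ) →+ Γ}
    {w : Fin (n + 1) → ℝ} (hw : w 0 < 0) (hκ : Refines κ w) {I : Ideal (MixedRing R n)}
    (hI : HasXComponents I) {f : MixedRing R n} (hf : f ∈ I)
    (h : ∀ e ∈ termSupport f, MvPolynomial.monomial e (termCoeff e f) ∉ leadIdeal κ I) :
    f = 0 := by
  by_contra h0
  obtain ⟨m, hm⟩ := exists_isLead hw hκ h0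
  exact h m hm.1 (monomial_mem_leadIdeal hI hf hm)

/-- The `x`-homogeneous elements `g i` of `I` form a reduced standard basis of `I` with leading
exponents `m i`. -/
structure IsReducedBasis (κ : (Fin (n + 1) →₀ ℕ) →+ Γ) (I : Ideal (MixedRing R n)) {ι : Type*}
    (g : ι → MixedRing R n) (m : ι → Fin (n + 1) →₀ ℕ) : Prop where
  mem : ∀ i, g i ∈ I
  form : ∀ i, IsXForm (xDegree (m i)) (g i)
  lead : ∀ i, IsLead κ (g i) (m i)
  span : termIdeal g m = leadIdeal κ I
  reduced : ∀ i, ∀ e ∈ termSupport (g i),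
    MvPolynomial.monomial e (termCoeff e (g i)) ∈ leadIdeal κ I → e = m i

/-- Finitely many leading terms generate the leading ideal. Reducing the tails of the corresponding
elements leaves these terms unchanged, coefficients included, so the term ideal is the same before
and after. -/
theorem exists_isReducedBasis [IsNoetherianRing R] [IsOrderedCancelAddMonoid Γ]
    {κ : (Fin (n + 1) →₀ ℕ) →+ Γ} {w : Fin (n + 1) → ℝ} (hw : w 0 < 0) (hκ : Refines κ w)
    (I : Ideal (MixedRing R n)) :
    ∃ (k : ℕ) (g : Fin k → MixedRing R n) (m : Fin k → Fin (n + 1) →₀ ℕ),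
      IsReducedBasis κ I g m := by
  obtain ⟨s, hs, hspan⟩ := (Submodule.fg_span_iff_fg_span_finset_subset _).1
    (IsNoetherian.noetherian (leadIdeal κ I))
  have hs' : ∀ p : s, ∃ f ∈ I, ∃ m, IsXForm (xDegree m) f ∧ IsLead κ f m ∧
    MvPolynomial.monomial m (termCoeff m f) = (p : PolyRing R n) := fun p => hs p.2
  choose f hfI m hfm hm hp using hs'
  have h := fun p => exists_tail_reduction hw hκ hfm hm hfI (hfm p) (hfI p) (hm p)
  choose g hgI hgm hgl hgc hgr using h
  have hg : termIdeal g m = leadIdeal κ I := by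
    rw [leadIdeal, Ideal.span, hspan, termIdeal, Ideal.span]
    congr 1
    ext q
    simp only [Set.mem_range, hgc, hp]
    simp
  have hf : termIdeal f m = leadIdeal κ I := by
    rw [← hg, termIdeal, termIdeal]
    simp only [hgc]
  refine ⟨s.card, g ∘ s.equivFin.symm, m ∘ s.equivFin.symm, fun i => hgI _, fun i => hgm _,
    fun i => hgl _, ?_, ?_⟩
  · rw [← hg, termIdeal, termIdeal]
    congr 1
    exact s.equivFin.symm.surjective.range_comp
      (fun i => MvPolynomial.monomial (m i) (termCoeff (m i) (g i)))
  · intro i e he hmem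
    by_contra hne
    rw [← hf] at hmem
    exact hgr _ e he hne hmem

/-- Were the `κ'`-leading term of some `f` in `I` outside the old leading ideal, tail reduction
along `κ'` would give a nonzero element of `I` with no term in that ideal, which `κ` forbids. -/
theorem IsReducedBasis.of_isLead [IsOrderedCancelAddMonoid Γ] {Γ' : Type*} [AddCommMonoid Γ']
    [LinearOrder Γ'] [IsOrderedCancelAddMonoid Γ'] {κ : (Fin (n + 1) →₀ ℕ) →+ Γ}
    {κ' : (Fin (n + 1) →₀ ℕ) →+ Γ'} {w v : Fin (n + 1) → ℝ} (hw : w 0 < 0) (hκ : Refines κ w)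
    (hv : v 0 < 0) (hκ' : Refines κ' v) {I : Ideal (MixedRing R n)} (hI : HasXComponents I)
    {ι : Type*} [Fintype ι] {g : ι → MixedRing R n} {m : ι → Fin (n + 1) →₀ ℕ}
    (h : IsReducedBasis κ I g m) (hl : ∀ i, IsLead κ' (g i) (m i)) :
    IsReducedBasis κ' I g m := by
  have heq : leadIdeal κ' I = leadIdeal κ I := by
    refine le_antisymm (Ideal.span_le.2 ?_) ?_
    · rintro _ ⟨f, hf, s, hfs, hs, rfl⟩
      by_contra hcon
      obtain ⟨r, hrI, -, hrl, hrc, hr⟩ := exists_tail_reduction hv hκ' h.form hl h.mem hfs hf hs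
      rw [h.span] at hr
      have h0 : r = 0 := by
        refine eq_zero_of_forall_notMem_leadIdeal hw hκ hI hrI fun e he => ?_
        by_cases hes : e = s
        · rw [hes, hrc]
          exact hcon
        · exact hr e he hes
      have := hrl.1
      simp [mem_termSupport, h0] at this
    · rw [← h.span]
      refine Ideal.span_le.2 ?_
      rintro _ ⟨i, rfl⟩
      exact Ideal.subset_span ⟨g i, h.mem i, m i, h.form i, hl i, rfl⟩
  exact ⟨h.mem, h.form, hl, heq ▸ h.span, heq ▸ h.reduced⟩

/-! ### Initial forms and initial ideals -/

theorem coeff_initialForm_of_mem {w : Fin (n + 1) → ℝ} (hw : w 0 < 0) {f : MixedRing R n}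
    {e : Fin (n + 1) →₀ ℕ} (he : e ∈ initialSupport w f) :
    (initialForm w f).coeff e = termCoeff e f := by
  classical
  rw [coeff_initialForm hw, if_pos he]

theorem coeff_initialForm_ne_zero {w : Fin (n + 1) → ℝ} (hw : w 0 < 0) {f : MixedRing R n}
    {e : Fin (n + 1) →₀ ℕ} :
    (initialForm w f).coeff e ≠ 0 ↔ e ∈ initialSupport w f := by
  classical
  rw [coeff_initialForm hw]
  split_ifs with h
  · exact ⟨fun _ => h, fun _ => h.1⟩
  · simp [h]

theorem initialForm_congr {w v : Fin (n + 1) → ℝ} {f : MixedRing R n}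
    (h : initialSupport w f = initialSupport v f) : initialForm w f = initialForm v f := by
  rw [initialForm, initialForm, h]

theorem IsLead.mem_initialSupport_iff {κ : (Fin (n + 1) →₀ ℕ) →+ Γ} {w : Fin (n + 1) → ℝ}
    (hκ : Refines κ w) {f : MixedRing R n} {m : Fin (n + 1) →₀ ℕ} (hm : IsLead κ f m)
    {e : Fin (n + 1) →₀ ℕ} :
    e ∈ initialSupport w f ↔ e ∈ termSupport f ∧ weight w e = weight w m := by
  refine ⟨fun he => ⟨he.1, le_antisymm (hκ.weight_le (hm.2 e he.1)) (he.2 m hm.1)⟩,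
    fun he => ⟨he.1, fun e' he' => ?_⟩⟩
  rw [he.2]
  exact hκ.weight_le (hm.2 e' he')

theorem initialForm_mem_initialIdeal {w : Fin (n + 1) → ℝ} {I : Ideal (MixedRing R n)}
    {f : MixedRing R n} (hf : f ∈ I) : initialForm w f ∈ initialIdeal w I :=
  Ideal.subset_span ⟨f, hf, rfl⟩

theorem exists_coeff_eq {S : Set (Fin (n + 1) →₀ ℕ)} (hS : S.Finite)
    (c : (Fin (n + 1) →₀ ℕ) → R) (hc : ∀ e, c e ≠ 0 → e ∈ S) :
    ∃ p : PolyRing R n, ∀ e, p.coeff e = c e := by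
  classical
  refine ⟨∑ e ∈ hS.toFinset, MvPolynomial.monomial e (c e), fun e => ?_⟩
  simp only [MvPolynomial.coeff_sum, MvPolynomial.coeff_monomial, Finset.sum_ite_eq',
    Set.Finite.mem_toFinset]
  split_ifs with h
  · rfl
  · by_contra h'
    exact h (hc e (Ne.symm h'))

/-- The part of weight `c` of an element of the initial ideal is the part of weight `c` of an
element of `I` without terms of higher weight. -/
theorem exists_termCoeff_eq_of_mem_initialIdeal {w : Fin (n + 1) → ℝ} (hw : w 0 < 0)
    {I : Ideal (MixedRing R n)} {p : PolyRing R n} (hp : p ∈ initialIdeal w I) (c : ℝ) :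
    ∃ f ∈ I, (∀ e ∈ termSupport f, weight w e ≤ c) ∧
      ∀ e, weight w e = c → termCoeff e f = p.coeff e := by
  classical
  have zero : ∀ c : ℝ, ∃ f ∈ I, (∀ e ∈ termSupport f, weight w e ≤ c) ∧
      ∀ e, weight w e = c → termCoeff e f = (0 : PolyRing R n).coeff e := fun c =>
    ⟨0, I.zero_mem, fun e he => absurd (termCoeff_zero e) he, by simp⟩
  have add : ∀ (p q : PolyRing R n) (c : ℝ),
      (∃ f ∈ I, (∀ e ∈ termSupport f, weight w e ≤ c) ∧
        ∀ e, weight w e = c → termCoeff e f = p.coeff e) →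
      (∃ f ∈ I, (∀ e ∈ termSupport f, weight w e ≤ c) ∧
        ∀ e, weight w e = c → termCoeff e f = q.coeff e) →
      ∃ f ∈ I, (∀ e ∈ termSupport f, weight w e ≤ c) ∧
        ∀ e, weight w e = c → termCoeff e f = (p + q).coeff e := by
    rintro p q c ⟨f, hf, hf1, hf2⟩ ⟨g, hg, hg1, hg2⟩
    refine ⟨f + g, I.add_mem hf hg, fun e he => ?_, fun e he => ?_⟩
    · by_contra hlt
      have h1 : termCoeff e f = 0 := by
        by_contra h
        exact hlt (hf1 e h)
      have h2 : termCoeff e g = 0 := by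
        by_contra h
        exact hlt (hg1 e h)
      exact he (by rw [termCoeff_add, h1, h2, add_zero])
    · rw [termCoeff_add, MvPolynomial.coeff_add, hf2 e he, hg2 e he]
  induction hp using Submodule.span_induction generalizing c with
  | mem p hp =>
    obtain ⟨f, hf, rfl⟩ := hp
    by_cases h : ∃ e ∈ initialSupport w f, weight w e = c
    · obtain ⟨e₀, he₀, rfl⟩ := h
      refine ⟨f, hf, he₀.2, fun e he => ?_⟩
      rw [coeff_initialForm hw]
      split_ifs with h'
      · rfl
      · by_contra hne
        exact h' ⟨hne, fun e' he' => he ▸ he₀.2 e' he'⟩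
    · obtain ⟨g, hg, hg1, hg2⟩ := zero c
      refine ⟨g, hg, hg1, fun e he => ?_⟩
      rw [hg2 e he, coeff_initialForm hw, if_neg fun h' => h ⟨e, h', he⟩,
        MvPolynomial.coeff_zero]
  | zero => exact zero c
  | add p q _ _ hp hq => exact add p q c (hp c) (hq c)
  | smul a p _ hp =>
    rw [smul_eq_mul]
    -- Multiplication by a monomial shifts weights by a constant, so the part of weight `c` comes
    -- from the part of weight `c - weight w u`.
    induction a using MvPolynomial.induction_on' generalizing c with
    | monomial u r =>
      obtain ⟨f, hf, hf1, hf2⟩ := hp (c - weight w u)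
      refine ⟨mixedTerm u r * f, I.mul_mem_left _ hf, fun e he => ?_, fun e he => ?_⟩
      · rw [mem_termSupport, termCoeff_mixedTerm_mul] at he
        split_ifs at he with h
        · have := hf1 (e - u) (right_ne_zero_of_mul he)
          rw [← tsub_add_cancel_of_le h, weight_add]
          linarith
        · exact absurd rfl he
      · rw [termCoeff_mixedTerm_mul, MvPolynomial.coeff_monomial_mul']
        by_cases h : u ≤ e
        · rw [if_pos h, if_pos h, hf2]
          rw [← tsub_add_cancel_of_le h, weight_add] at he
          linarith
        · rw [if_neg h, if_neg h]
    | add a b ha hb =>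
      rw [add_mul]
      exact add _ _ c (ha c) (hb c)

/-- Lift the part of `p` of weight `weight w e₀` to an element of `I` with no higher terms; its
leading exponent then has exactly this weight. -/
theorem exists_mem_leadIdeal_of_mem_initialIdeal {κ : (Fin (n + 1) →₀ ℕ) →+ Γ}
    {w : Fin (n + 1) → ℝ} (hw : w 0 < 0) (hκ : Refines κ w) {I : Ideal (MixedRing R n)}
    (hI : HasXComponents I) {p : PolyRing R n} (hp : p ∈ initialIdeal w I)
    {e₀ : Fin (n + 1) →₀ ℕ} (he₀ : p.coeff e₀ ≠ 0) :
    ∃ e, weight w e = weight w e₀ ∧ p.coeff e ≠ 0 ∧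
      MvPolynomial.monomial e (p.coeff e) ∈ leadIdeal κ I := by
  obtain ⟨f, hf, hf1, hf2⟩ := exists_termCoeff_eq_of_mem_initialIdeal hw hp (weight w e₀)
  have h0 : e₀ ∈ termSupport f := by
    rw [mem_termSupport, hf2 _ rfl]
    exact he₀
  obtain ⟨m, hm⟩ := exists_isLead hw hκ (f := f) (by rintro rfl; exact h0 (termCoeff_zero _))
  have hwm : weight w m = weight w e₀ := le_antisymm (hf1 m hm.1) (hκ.weight_le (hm.2 _ h0))
  refine ⟨m, hwm, ?_, ?_⟩
  · rw [← hf2 m hwm]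
    exact hm.1
  · rw [← hf2 m hwm]
    exact monomial_mem_leadIdeal hI hf hm

/-- Each initial form of `g i` lies in the common initial ideal, so each of its `w`-homogeneous
parts contains a term in the leading ideal. Reducedness allows only `m i` there. -/
theorem IsReducedBasis.initialSupport_eq {κ : (Fin (n + 1) →₀ ℕ) →+ Γ} {w v : Fin (n + 1) → ℝ}
    (hw : w 0 < 0) (hκ : Refines κ w) (hv : v 0 < 0) {I : Ideal (MixedRing R n)}
    (hI : HasXComponents I) {ι : Type*} {g : ι → MixedRing R n}
    {m : ι → Fin (n + 1) →₀ ℕ} (h : IsReducedBasis κ I g m)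
    (heq : initialIdeal v I = initialIdeal w I) (i : ι) :
    initialSupport v (g i) = initialSupport w (g i) := by
  have key : ∀ e₀ ∈ initialSupport v (g i),
      m i ∈ initialSupport v (g i) ∧ weight w e₀ = weight w (m i) := by
    intro e₀ he₀
    obtain ⟨e, he1, he2, he3⟩ := exists_mem_leadIdeal_of_mem_initialIdeal hw hκ hI
      (heq ▸ initialForm_mem_initialIdeal (w := v) (h.mem i))
      ((coeff_initialForm_ne_zero hv).2 he₀)
    rw [coeff_initialForm_ne_zero hv] at he2
    rw [coeff_initialForm_of_mem hv he2] at he3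
    have := h.reduced i e he2.1 he3
    subst this
    exact ⟨he2, he1.symm⟩
  have hmv : m i ∈ initialSupport v (g i) := by
    have hne : g i ≠ 0 := fun h0 => (h.lead i).1 (by simp [h0])
    obtain ⟨e, he⟩ := exists_isLead hv (refines_weightOrder v (lexOrder_injective n)) hne
    exact (key e ((he.mem_initialSupport_iff
      (refines_weightOrder v (lexOrder_injective n))).2 ⟨he.1, rfl⟩)).1
  ext e₀
  rw [(h.lead i).mem_initialSupport_iff hκ]
  refine ⟨fun he => ⟨he.1, (key e₀ he).2⟩, fun he => ?_⟩
  have he' : e₀ ∈ initialSupport w (g i) := ((h.lead i).mem_initialSupport_iff hκ).2 he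
  -- Here the `v`-initial form of `f` is the part of the `w`-initial form of `g i` of the same
  -- `v`-weight as `e₀`. It lies in the common initial ideal, so this part contains `m i`.
  obtain ⟨f, hf, hf1, hf2⟩ := exists_termCoeff_eq_of_mem_initialIdeal hv
    (heq ▸ initialForm_mem_initialIdeal (w := w) (h.mem i)) (weight v e₀)
  have hfe : e₀ ∈ termSupport f := by
    rw [mem_termSupport, hf2 _ rfl]
    exact (coeff_initialForm_ne_zero hw).2 he'
  obtain ⟨e, he1, he2, he3⟩ := exists_mem_leadIdeal_of_mem_initialIdeal hw hκ hI
      (heq ▸ initialForm_mem_initialIdeal (w := v) hf)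
      ((coeff_initialForm_ne_zero hv).2 (⟨hfe, hf1⟩ : e₀ ∈ initialSupport v f))
  rw [coeff_initialForm_ne_zero hv] at he2
  have hve : weight v e = weight v e₀ := le_antisymm (hf1 e he2.1) (he2.2 e₀ hfe)
  have hge : e ∈ initialSupport w (g i) := by
    rw [← coeff_initialForm_ne_zero hw, ← hf2 e hve]
    exact he2.1
  rw [coeff_initialForm_of_mem hv he2, hf2 e hve, coeff_initialForm_of_mem hw hge] at he3
  have := h.reduced i e hge.1 he3
  subst this
  exact ⟨he.1, fun e' he' => hve ▸ hmv.2 e' he'⟩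

/-- Division gives `f = ∑ q i * g i` with no summand exceeding the weight of `f`, so the part of
weight `c` of `f` is a combination of initial forms. -/
theorem IsReducedBasis.exists_mem_span_initialForm [IsOrderedCancelAddMonoid Γ]
    {κ : (Fin (n + 1) →₀ ℕ) →+ Γ} {w : Fin (n + 1) → ℝ}
    (hw : w 0 < 0) (hκ : Refines κ w) {I : Ideal (MixedRing R n)}
    (hI : HasXComponents I) {ι : Type*} [Fintype ι] {g : ι → MixedRing R n}
    {m : ι → Fin (n + 1) →₀ ℕ} (h : IsReducedBasis κ I g m) {f : MixedRing R n} (hf : f ∈ I)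
    {d : ℕ} (hfd : IsXForm d f) {c : ℝ} (hc : ∀ e ∈ termSupport f, weight w e ≤ c) :
    ∃ p ∈ Ideal.span (Set.range fun i => initialForm w (g i)),
      ∀ e, p.coeff e = if weight w e = c then termCoeff e f else 0 := by
  classical
  obtain ⟨q, r, hfr, -, hr, hq, -⟩ := exists_reduction hw hκ h.form h.lead hfd
  have hr0 : r = 0 := by
    refine eq_zero_of_forall_notMem_leadIdeal hw hκ hI ?_ (h.span ▸ hr)
    have : r = f - ∑ i, q i * g i := by rw [hfr]; ring
    rw [this]
    exact I.sub_mem hf (I.sum_mem fun i _ => I.mul_mem_left _ (h.mem i))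
  -- The part of `q i` of weight `c - weight w (m i)`, which is a polynomial because `w 0 < 0`.
  have hQ : ∀ i, ∃ Q : PolyRing R n, ∀ e, Q.coeff e =
      if weight w (e + m i) = c then termCoeff e (q i) else 0 := by
    intro i
    refine exists_coeff_eq (finite_weight_ge hw (finite_tail_termSupport (q i))
      (c - weight w (m i))) _ fun e he => ?_
    have h1 : weight w (e + m i) = c := by
      by_contra h1
      exact he (if_neg h1)
    rw [if_pos h1] at he
    rw [weight_add] at h1
    exact ⟨⟨e, he, rfl⟩, by linarith⟩
  choose Q hQ using hQ
  refine ⟨∑ i, Q i * initialForm w (g i), Ideal.sum_mem _ fun i _ =>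
    Ideal.mul_mem_left _ _ (Ideal.subset_span ⟨i, rfl⟩), fun e => ?_⟩
  have hmem : ∀ i e, e ∈ initialSupport w (g i) ↔
      e ∈ termSupport (g i) ∧ weight w e = weight w (m i) := fun i e =>
    (h.lead i).mem_initialSupport_iff hκ
  have hfe : termCoeff e f = ∑ i, termCoeff e (q i * g i) := by
    rw [hfr, hr0, add_zero, termCoeff_sum]
  rw [MvPolynomial.coeff_sum]
  split_ifs with hec
  · rw [hfe]
    refine Finset.sum_congr rfl fun i _ => ?_
    rw [MvPolynomial.coeff_mul, termCoeff_mul]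
    refine Finset.sum_congr rfl ?_
    rintro ⟨p1, p2⟩ hp
    rw [HasAntidiagonal.mem_antidiagonal] at hp
    simp only at hp ⊢
    rw [← hp, weight_add] at hec
    by_cases h1 : termCoeff p1 (q i) = 0
    · rw [hQ, h1, ite_self, zero_mul, zero_mul]
    by_cases h2 : termCoeff p2 (g i) = 0
    · rw [coeff_initialForm hw, h2, ite_self, mul_zero, mul_zero]
    obtain ⟨e', he', hle⟩ := hq i p1 h1
    have h3 := (hκ.weight_le hle).trans (hc e' he')
    rw [weight_add] at h3
    have h4 := hκ.weight_le ((h.lead i).2 p2 h2)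
    rw [hQ, if_pos (by rw [weight_add]; linarith),
      coeff_initialForm_of_mem hw ((hmem i p2).2 ⟨h2, by linarith⟩)]
  · refine Finset.sum_eq_zero fun i _ => ?_
    rw [MvPolynomial.coeff_mul]
    refine Finset.sum_eq_zero ?_
    rintro ⟨p1, p2⟩ hp
    rw [HasAntidiagonal.mem_antidiagonal] at hp
    simp only at hp ⊢
    rw [← hp, weight_add] at hec
    rw [hQ, coeff_initialForm hw, weight_add]
    split_ifs with h1 h2
    · rw [hmem] at h2
      exact absurd (by rw [h2.2]; exact h1) hec
    all_goals simp

theorem IsReducedBasis.initialIdeal_eq_span [IsOrderedCancelAddMonoid Γ]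
    {κ : (Fin (n + 1) →₀ ℕ) →+ Γ} {w : Fin (n + 1) → ℝ}
    (hw : w 0 < 0) (hκ : Refines κ w) {I : Ideal (MixedRing R n)}
    (hI : HasXComponents I) {ι : Type*} [Fintype ι] {g : ι → MixedRing R n}
    {m : ι → Fin (n + 1) →₀ ℕ} (h : IsReducedBasis κ I g m) :
    initialIdeal w I = Ideal.span (Set.range fun i => initialForm w (g i)) := by
  classical
  refine le_antisymm (Ideal.span_le.2 ?_) (Ideal.span_le.2 ?_)
  · rintro _ ⟨f, hf, rfl⟩
    by_cases hf0 : f = 0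
    · have : initialForm w f = 0 := by
        ext e
        rw [coeff_initialForm hw]
        simp [hf0]
      rw [this]
      exact Ideal.zero_mem _
    obtain ⟨s, hs⟩ := exists_isLead hw hκ hf0
    have hp : ∀ d, ∃ p ∈ Ideal.span (Set.range fun i => initialForm w (g i)),
        ∀ e, p.coeff e = if weight w e = weight w s then
          termCoeff e (MvPolynomial.homogeneousComponent d f) else 0 := fun d =>
      h.exists_mem_span_initialForm hw hκ hI (hI f hf d)
        (fun e he => (mem_termSupport_homogeneousComponent.1 he).1)
        fun e he => hκ.weight_le (hs.2 e (mem_termSupport_homogeneousComponent.1 he).2)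
    choose p hp1 hp2 using hp
    have : initialForm w f = ∑ d ∈ range (f.totalDegree + 1), p d := by
      ext e
      rw [MvPolynomial.coeff_sum, coeff_initialForm hw]
      simp only [hp2, hs.mem_initialSupport_iff hκ]
      by_cases hwe : weight w e = weight w s
      · simp only [hwe, and_true, if_true]
        rw [← termCoeff_sum, MvPolynomial.sum_homogeneousComponent, mem_termSupport]
        split_ifs with h0
        · rfl
        · exact (not_not.1 h0).symm
      · simp [hwe]
    rw [this]
    exact Ideal.sum_mem _ fun d _ => hp1 d
  · rintro _ ⟨i, rfl⟩
    exact initialForm_mem_initialIdeal (h.mem i)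

/-- On the weights `v` for which the exponents `m i` still have maximal weight, the initial ideal
is determined by the initial forms of the `g i` and determines them. -/
theorem IsReducedBasis.initialIdeal_eq_iff [IsOrderedCancelAddMonoid Γ]
    {κ : (Fin (n + 1) →₀ ℕ) →+ Γ} {w : Fin (n + 1) → ℝ}
    (hw : w 0 < 0) (hκ : Refines κ w) {I : Ideal (MixedRing R n)}
    (hI : HasXComponents I) {ι : Type*} [Fintype ι] {g : ι → MixedRing R n}
    {m : ι → Fin (n + 1) →₀ ℕ} (h : IsReducedBasis κ I g m) {v : Fin (n + 1) → ℝ} (hv : v 0 < 0)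
    (hvm : ∀ i, ∀ e ∈ termSupport (g i), weight v e ≤ weight v (m i))
    {u : Fin (n + 1) → ℝ} (hu : u 0 < 0) :
    initialIdeal u I = initialIdeal v I ↔
      ∀ i, initialSupport u (g i) = initialSupport v (g i) := by
  have key : ∀ u : Fin (n + 1) → ℝ, u 0 < 0 →
      (∀ i, ∀ e ∈ termSupport (g i), weight u e ≤ weight u (m i)) →
      IsReducedBasis (weightOrder u κ) I g m := fun u hu hum =>
    h.of_isLead hw hκ hu (refines_weightOrder u hκ.1) hI fun i => ⟨(h.lead i).1, fun e he => by
      rw [weightOrder_le]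
      exact (hum i e he).lt_or_eq.imp id fun heq => ⟨heq, (h.lead i).2 e he⟩⟩
  have hv' := key v hv hvm
  refine ⟨fun heq i => hv'.initialSupport_eq hv (refines_weightOrder v hκ.1) hu hI heq i,
    fun heq => ?_⟩
  have hu' := key u hu fun i e he => by
    have : m i ∈ initialSupport u (g i) := by
      rw [heq i]
      exact ⟨(h.lead i).1, hvm i⟩
    exact this.2 e he
  rw [hv'.initialIdeal_eq_span hv (refines_weightOrder v hκ.1) hI,
    hu'.initialIdeal_eq_span hu (refines_weightOrder u hκ.1) hI]
  simp only [initialForm_congr (heq _)]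

/-! ### Finiteness of the set of leading ideals -/

/-- The exponents of the terms of `f` of lowest degree in `t` among those with the same
monomial in `x`. -/
def minimalSupport (f : MixedRing R n) : Set (Fin (n + 1) →₀ ℕ) :=
  {e | e ∈ termSupport f ∧ ∀ e' ∈ termSupport f, e'.tail = e.tail → e 0 ≤ e' 0}

theorem finite_minimalSupport (f : MixedRing R n) : (minimalSupport f).Finite := by
  refine Set.Finite.of_finite_image (f := Finsupp.tail)
    ((finite_tail_termSupport f).subset (Set.image_mono fun e he => he.1)) ?_
  intro e he e' he' hee
  rw [← Finsupp.cons_tail e, ← Finsupp.cons_tail e', hee,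
    le_antisymm (he.2 e' he'.1 hee.symm) (he'.2 e he.1 hee)]

theorem weight_eq_add_sum_tail (v : Fin (n + 1) → ℝ) (e : Fin (n + 1) →₀ ℕ) :
    weight v e = v 0 * e 0 + ∑ i : Fin n, v i.succ * (e.tail i : ℝ) := by
  rw [weight, Fin.sum_univ_succ]
  rfl

/-- Lowering the power of `t` raises the weight for every `v` with `v 0 < 0` at once, so one finite
set of exponents suffices for all weights. -/
theorem exists_mem_minimalSupport {f : MixedRing R n} {e : Fin (n + 1) →₀ ℕ}
    (he : e ∈ termSupport f) : ∃ e' ∈ minimalSupport f,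
      ∀ v : Fin (n + 1) → ℝ, v 0 < 0 → e = e' ∨ weight v e < weight v e' := by
  have hne : {e' | e' ∈ termSupport f ∧ e'.tail = e.tail}.Nonempty := ⟨e, he, rfl⟩
  obtain ⟨e', he', hmin⟩ := WellFounded.has_min (measure fun e' : Fin (n + 1) →₀ ℕ => e' 0).wf _ hne
  refine ⟨e', ⟨he'.1, fun e'' h1 h2 => not_lt.1 (hmin e'' ⟨h1, h2.trans he'.2⟩)⟩, fun v hv => ?_⟩
  have hle : e' 0 ≤ e 0 := not_lt.1 (hmin e ⟨he, rfl⟩)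
  rcases hle.eq_or_lt with h | h
  · left
    rw [← Finsupp.cons_tail e, ← Finsupp.cons_tail e', he'.2, h]
  · right
    rw [weight_eq_add_sum_tail, weight_eq_add_sum_tail, he'.2]
    have : (e' 0 : ℝ) < e 0 := by exact_mod_cast h
    nlinarith

/-- Noetherian induction on the ideal `J` of leading terms prescribed so far. If `J` is not yet
everything for some weight, there is `r` in `I` with no term in `J`. For any weight its leading
exponent is one of finitely many, and adjoining each candidate enlarges `J` strictly. -/
theorem finite_leadIdeals [IsNoetherianRing R] [IsOrderedCancelAddMonoid Γ]
    {κ : (Fin (n + 1) →₀ ℕ) →+ Γ} (hκ : Function.Injective κ) (I : Ideal (MixedRing R n)) :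
    {L | ∃ w : Fin (n + 1) → ℝ, w 0 < 0 ∧ leadIdeal (weightOrder w κ) I = L}.Finite := by
  have key : ∀ (J : Ideal (PolyRing R n)) (ι : Type) [Fintype ι] (g : ι → MixedRing R n)
      (m : ι → Fin (n + 1) →₀ ℕ), termIdeal g m = J → (∀ i, g i ∈ I) →
      (∀ i, IsXForm (xDegree (m i)) (g i)) →
      {L | ∃ w : Fin (n + 1) → ℝ, w 0 < 0 ∧ (∀ i, IsLead (weightOrder w κ) (g i) (m i)) ∧
        leadIdeal (weightOrder w κ) I = L}.Finite := by
    intro J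
    induction J using WellFoundedGT.induction with
    | _ J ih =>
    intro ι _ g m hJ hgI hgm
    by_cases hall : ∀ w : Fin (n + 1) → ℝ, w 0 < 0 →
        (∀ i, IsLead (weightOrder w κ) (g i) (m i)) → leadIdeal (weightOrder w κ) I ≤ J
    · refine (Set.finite_singleton J).subset ?_
      rintro _ ⟨w, hw, hl, rfl⟩
      refine le_antisymm (hall w hw hl) ?_
      rw [← hJ]
      refine Ideal.span_le.2 ?_
      rintro _ ⟨i, rfl⟩
      exact Ideal.subset_span ⟨g i, hgI i, m i, hgm i, hl i, rfl⟩
    · push Not at hall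
      obtain ⟨w, hw, hl, hnle⟩ := hall
      have : ∃ f ∈ I, ∃ s, IsXForm (xDegree s) f ∧ IsLead (weightOrder w κ) f s ∧
          MvPolynomial.monomial s (termCoeff s f) ∉ J := by
        by_contra! hcon
        refine hnle (Ideal.span_le.2 ?_)
        rintro _ ⟨f, hf, s, hfs, hs, rfl⟩
        exact hcon f hf s hfs hs
      obtain ⟨f, hf, s, hfs, hs, hsJ⟩ := this
      obtain ⟨r, hrI, hrd, hrl, hrc, hr⟩ := exists_tail_reduction hw
        (refines_weightOrder w hκ) hgm hl hgI hfs hf hs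
      have hrJ : ∀ e ∈ termSupport r, MvPolynomial.monomial e (termCoeff e r) ∉ J := by
        intro e he
        by_cases hes : e = s
        · rw [hes, hrc]
          exact hsJ
        · rw [← hJ]
          exact hr e he hes
      refine ((finite_minimalSupport r).biUnion (t := fun e =>
        {L | ∃ w : Fin (n + 1) → ℝ, w 0 < 0 ∧
          (∀ o : Option ι, IsLead (weightOrder w κ) (o.elim r g) (o.elim e m)) ∧
          leadIdeal (weightOrder w κ) I = L}) ?_).subset ?_
      · intro e he
        refine ih (termIdeal (fun o : Option ι => o.elim r g) fun o => o.elim e m) ?_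
          (Option ι) (fun o => o.elim r g) (fun o => o.elim e m) rfl ?_ ?_
        · refine lt_of_le_of_ne ?_ ?_
          · rw [← hJ]
            refine Ideal.span_mono ?_
            rintro _ ⟨i, rfl⟩
            exact ⟨some i, rfl⟩
          · intro heq
            refine hrJ e he.1 ?_
            rw [heq]
            exact Ideal.subset_span ⟨none, rfl⟩
        · rintro (_ | i)
          · exact hrI
          · exact hgI i
        · rintro (_ | i)
          · intro e' he'
            exact (hrd e' he').trans (hrd e he.1).symm
          · exact hgm i
      · rintro _ ⟨v, hv, hvl, rfl⟩
        have hr0 : r ≠ 0 := fun h0 => hrl.1 (by simp [h0])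
        obtain ⟨e, he⟩ := exists_isLead hv (refines_weightOrder v hκ) hr0
        obtain ⟨e', he', hlt⟩ := exists_mem_minimalSupport he.1
        have : e = e' := (hlt v hv).resolve_right (not_lt.2
          ((refines_weightOrder v hκ).weight_le (he.2 e' he'.1)))
        subst this
        simp only [Set.mem_iUnion]
        refine ⟨e, he', v, hv, ?_, rfl⟩
        rintro (_ | i)
        · exact he
        · exact hvl i
  refine (key _ Empty Empty.elim Empty.elim rfl (fun i => i.elim) fun i => i.elim).subset ?_
  rintro _ ⟨w, hw, rfl⟩
  exact ⟨w, hw, fun i => i.elim, rfl⟩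

end GroebnerFan

namespace GroebnerFan

open Finset Filter Topology

/-! ### Polyhedral cones given by finite sets of integral functionals -/

section Cones

variable {m : ℕ}

/-- The value of the integral functional `a` at `v`. -/
def pairing (a : Fin m → ℤ) (v : Fin m → ℝ) : ℝ := ∑ i, (a i : ℝ) * v i

@[simp] theorem pairing_zero (a : Fin m → ℤ) : pairing a 0 = 0 := by simp [pairing]

theorem pairing_add (a : Fin m → ℤ) (v u : Fin m → ℝ) :
    pairing a (v + u) = pairing a v + pairing a u := by
  simp [pairing, mul_add, Finset.sum_add_distrib]

theorem pairing_smul (a : Fin m → ℤ) (c : ℝ) (v : Fin m → ℝ) :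
    pairing a (c • v) = c * pairing a v := by
  simp only [pairing, Pi.smul_apply, smul_eq_mul, Finset.mul_sum]
  exact Finset.sum_congr rfl fun i _ => by ring

theorem pairing_sub (a : Fin m → ℤ) (v u : Fin m → ℝ) :
    pairing a (v - u) = pairing a v - pairing a u := by
  simp [pairing, mul_sub, Finset.sum_sub_distrib]

theorem pairing_neg_left (a : Fin m → ℤ) (v : Fin m → ℝ) : pairing (-a) v = -pairing a v := by
  simp [pairing]

theorem continuous_pairing (a : Fin m → ℤ) : Continuous (pairing a) := by
  unfold pairing
  fun_prop

/-- The cone on which all functionals in `A` are nonnegative. -/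
def coneOf (A : Finset (Fin m → ℤ)) : Set (Fin m → ℝ) := {v | ∀ a ∈ A, 0 ≤ pairing a v}

/-- The smallest face of `coneOf A` that contains `z`. -/
def faceAt (A : Finset (Fin m → ℤ)) (z : Fin m → ℝ) : Set (Fin m → ℝ) :=
  {u | u ∈ coneOf A ∧ ∀ a ∈ A, pairing a z = 0 → pairing a u = 0}

variable {A : Finset (Fin m → ℤ)} {z u v : Fin m → ℝ}

theorem mem_faceAt_self (hz : z ∈ coneOf A) : z ∈ faceAt A z := ⟨hz, fun _ _ h => h⟩

theorem faceAt_subset (hu : u ∈ faceAt A z) : faceAt A u ⊆ faceAt A z :=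
  fun _ hv => ⟨hv.1, fun a ha h => hv.2 a ha (hu.2 a ha h)⟩

theorem zero_mem_faceAt : (0 : Fin m → ℝ) ∈ faceAt A z :=
  ⟨fun a _ => by simp, fun a _ _ => by simp⟩

theorem add_mem_faceAt (hu : u ∈ faceAt A z) (hv : v ∈ faceAt A z) : u + v ∈ faceAt A z :=
  ⟨fun a ha => by rw [pairing_add]; exact add_nonneg (hu.1 a ha) (hv.1 a ha),
    fun a ha h => by rw [pairing_add, hu.2 a ha h, hv.2 a ha h, add_zero]⟩

theorem isRationalPolyhedralCone_faceAt : IsRationalPolyhedralCone (faceAt A z) := by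
  classical
  refine ⟨A ∪ (A.filter fun a => pairing a z = 0).image fun a => -a, ?_⟩
  ext v
  change v ∈ faceAt A z ↔ ∀ a ∈ _, 0 ≤ pairing a v
  constructor
  · intro hv a ha
    simp only [mem_union, mem_image, mem_filter] at ha
    rcases ha with ha | ⟨b, ⟨hb, hbz⟩, rfl⟩
    · exact hv.1 a ha
    · rw [pairing_neg_left, hv.2 b hb hbz, neg_zero]
  · intro h
    have h1 : v ∈ coneOf A := fun a ha => h a (mem_union_left _ ha)
    refine ⟨h1, fun a ha haz => le_antisymm ?_ (h1 a ha)⟩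
    have := h (-a) (mem_union_right _ (mem_image.2 ⟨a, mem_filter.2 ⟨ha, haz⟩, rfl⟩))
    rw [pairing_neg_left] at this
    linarith

/-- The supporting functional is the sum of the functionals in `A` that vanish at `u`. -/
theorem isFace_faceAt (hu : u ∈ faceAt A z) : IsFace (faceAt A u) (faceAt A z) := by
  classical
  have hsum : ∀ v : Fin m → ℝ, ∑ i, (∑ a ∈ A with pairing a u = 0, (a i : ℝ)) * v i =
      ∑ a ∈ A with pairing a u = 0, pairing a v := by
    intro v
    simp only [pairing, Finset.sum_mul]
    exact Finset.sum_comm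
  refine ⟨fun i => ∑ a ∈ A with pairing a u = 0, (a i : ℝ), fun v hv => ?_, ?_⟩
  · rw [hsum]
    exact Finset.sum_nonneg fun a ha => hv.1 a (mem_filter.1 ha).1
  · ext v
    simp only [Set.mem_ofPred_eq, hsum]
    constructor
    · intro hv
      exact ⟨faceAt_subset hu hv, Finset.sum_eq_zero fun a ha =>
        hv.2 a (mem_filter.1 ha).1 (mem_filter.1 ha).2⟩
    · rintro ⟨hv, h0⟩
      rw [Finset.sum_eq_zero_iff_of_nonneg fun a ha => hv.1 a (mem_filter.1 ha).1] at h0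
      exact ⟨hv.1, fun a ha h => h0 a (mem_filter.2 ⟨ha, h⟩)⟩

/-- A point in the relative interior of a subcone. -/
theorem exists_relative_interior {D : Set (Fin m → ℝ)} (hD : D ⊆ coneOf A) (h0 : 0 ∈ D)
    (hadd : ∀ u ∈ D, ∀ v ∈ D, u + v ∈ D) :
    ∃ u ∈ D, ∀ v ∈ D, ∀ a ∈ A, pairing a u = 0 → pairing a v = 0 := by
  classical
  have : ∀ a : Fin m → ℤ, ∃ u ∈ D, ∀ v ∈ D, pairing a u = 0 → pairing a v = 0 := by
    intro a
    by_cases h : ∃ u ∈ D, pairing a u ≠ 0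
    · obtain ⟨u, hu, hne⟩ := h
      exact ⟨u, hu, fun v _ h => absurd h hne⟩
    · push Not at h
      exact ⟨0, h0, fun v hv _ => h v hv⟩
  choose p hp1 hp2 using this
  refine ⟨∑ a ∈ A, p a, Finset.sum_induction _ (· ∈ D) (fun u v hu hv => hadd u hu v hv) h0
    fun a _ => hp1 a, fun v hv a ha h => hp2 a v hv ?_⟩
  have hs : pairing a (∑ b ∈ A, p b) = ∑ b ∈ A, pairing a (p b) := by
    simp only [pairing, Finset.sum_apply, Finset.mul_sum]
    exact Finset.sum_comm
  rw [hs, Finset.sum_eq_zero_iff_of_nonneg fun b _ => hD (hp1 b) a ha] at h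
  exact h a ha

/-- The right-hand side involves only the set `faceAt A z`, not the functionals. Hence cones with a
common face have the same smaller faces inside it. -/
theorem mem_faceAt_iff (hu : u ∈ faceAt A z) :
    v ∈ faceAt A u ↔ v ∈ faceAt A z ∧ ∃ ε : ℝ, 0 < ε ∧ u - ε • v ∈ faceAt A z := by
  constructor
  · intro hv
    have hvz := faceAt_subset hu hv
    refine ⟨hvz, ?_⟩
    have hev : ∀ᶠ ε : ℝ in 𝓝[>] 0, ∀ a ∈ A, 0 ≤ pairing a (u - ε • v) := by
      rw [Filter.eventually_all_finset]
      intro a ha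
      rcases (hu.1 a ha).eq_or_lt with h | h
      · refine Eventually.of_forall fun ε => ?_
        rw [pairing_sub, pairing_smul, hv.2 a ha h.symm, ← h]
        simp
      · refine nhdsWithin_le_nhds ?_
        have hcont : Tendsto (fun ε : ℝ => pairing a (u - ε • v)) (𝓝 0)
            (𝓝 (pairing a (u - (0 : ℝ) • v))) := by
          refine ((continuous_pairing a).comp ?_).tendsto 0
          fun_prop
        rw [zero_smul, sub_zero] at hcont
        exact (hcont.eventually_const_lt h).mono fun _ => le_of_lt
    obtain ⟨ε, hε, hpos⟩ := (hev.and self_mem_nhdsWithin).exists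
    refine ⟨ε, hpos, hε, fun a ha h => ?_⟩
    rw [pairing_sub, pairing_smul, hu.2 a ha h, hvz.2 a ha h]
    simp
  · rintro ⟨hvz, ε, hε, h⟩
    refine ⟨hvz.1, fun a ha h0 => le_antisymm ?_ (hvz.1 a ha)⟩
    have := h.1 a ha
    rw [pairing_sub, pairing_smul, h0] at this
    nlinarith

theorem exists_faceAt_eq_of_isFace {F : Set (Fin m → ℝ)} (hF : IsFace F (faceAt A z)) :
    ∃ u ∈ coneOf A, faceAt A u = F := by
  obtain ⟨b, hb, rfl⟩ := hF
  have hadd : ∀ u v : Fin m → ℝ, ∑ i, b i * (u + v) i = ∑ i, b i * u i + ∑ i, b i * v i := by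
    intro u v
    simp [mul_add, Finset.sum_add_distrib]
  obtain ⟨u, hu, hmin⟩ := exists_relative_interior (A := A)
    (D := {v | v ∈ faceAt A z ∧ ∑ i, b i * v i = 0}) (fun v hv => hv.1.1)
    ⟨zero_mem_faceAt, by simp⟩ fun u hu v hv =>
      ⟨add_mem_faceAt hu.1 hv.1, by rw [hadd, hu.2, hv.2, add_zero]⟩
  refine ⟨u, hu.1.1, Set.Subset.antisymm (fun v hv => ?_)
    fun v hv => ⟨hv.1.1, hmin v hv⟩⟩
  obtain ⟨hvz, ε, hε, h⟩ := (mem_faceAt_iff hu.1).1 hv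
  refine ⟨hvz, le_antisymm ?_ (hb v hvz)⟩
  have h1 := hb _ h
  have h2 : ∑ i, b i * (u - ε • v) i = ∑ i, b i * u i - ε * ∑ i, b i * v i := by
    simp only [Pi.sub_apply, Pi.smul_apply, smul_eq_mul, mul_sub, Finset.sum_sub_distrib,
      Finset.mul_sum]
    congr 1
    exact Finset.sum_congr rfl fun i _ => by ring
  rw [h2, hu.2] at h1
  nlinarith

theorem closure_relative_interior (hz : z ∈ coneOf A) :
    closure {u | ∀ a ∈ A, (pairing a z = 0 → pairing a u = 0) ∧
      (0 < pairing a z → 0 < pairing a u)} = faceAt A z := by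
  apply Set.Subset.antisymm
  · refine closure_minimal ?_ ?_
    · intro u hu
      refine ⟨fun a ha => ?_, fun a ha => (hu a ha).1⟩
      rcases (hz a ha).eq_or_lt with h | h
      · exact ((hu a ha).1 h.symm).ge
      · exact ((hu a ha).2 h).le
    · have : faceAt A z = ⋂ a ∈ A, ({u | 0 ≤ pairing a u} ∩
          {u | pairing a z = 0 → pairing a u = 0}) := by
        ext u
        simp only [faceAt, coneOf, Set.mem_iInter, Set.mem_inter_iff, Set.mem_ofPred_eq]
        exact ⟨fun h a ha => ⟨h.1 a ha, h.2 a ha⟩,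
          fun h => ⟨fun a ha => (h a ha).1, fun a ha => (h a ha).2⟩⟩
      rw [this]
      refine isClosed_biInter fun a _ => (isClosed_le continuous_const
        (continuous_pairing a)).inter ?_
      by_cases h : pairing a z = 0
      · simp only [h, true_imp_iff]
        exact isClosed_eq (continuous_pairing a) continuous_const
      · simp [h]
  · intro u hu
    have hcont : Tendsto (fun ε : ℝ => u + ε • z) (𝓝[>] 0) (𝓝 u) := by
      have : Tendsto (fun ε : ℝ => u + ε • z) (𝓝 0) (𝓝 (u + (0 : ℝ) • z)) :=
        Continuous.tendsto (by fun_prop) 0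
      rw [zero_smul, add_zero] at this
      exact this.mono_left nhdsWithin_le_nhds
    refine mem_closure_of_tendsto hcont ?_
    filter_upwards [self_mem_nhdsWithin] with ε hε a ha
    rw [pairing_add, pairing_smul]
    refine ⟨fun h => by rw [hu.2 a ha h, h]; simp, fun h => ?_⟩
    have := hu.1 a ha
    have : 0 < ε * pairing a z := mul_pos hε h
    linarith

/-- Here `p` is a direction in the tangent cone at `u`. Scaling up `u` makes every functional
positive at `u` dominate. -/
theorem eventually_mem_coneOf {p : Fin m → ℝ} (hu : u ∈ coneOf A)
    (hp : ∀ a ∈ A, pairing a u = 0 → 0 ≤ pairing a p) :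
    ∀ᶠ c : ℝ in atTop, p + c • u ∈ coneOf A ∧ u ∈ faceAt A (p + c • u) := by
  have : ∀ᶠ c : ℝ in atTop, ∀ a ∈ A, 0 < pairing a u → 0 < pairing a (p + c • u) := by
    rw [Filter.eventually_all_finset]
    intro a ha
    by_cases h : 0 < pairing a u
    · have hT : Tendsto (fun c : ℝ => pairing a p + c * pairing a u) atTop atTop :=
        tendsto_atTop_add_const_left _ _ (tendsto_id.atTop_mul_const h)
      filter_upwards [hT.eventually_gt_atTop 0] with c hc _
      rwa [pairing_add, pairing_smul]
    · simp [h]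
  filter_upwards [this] with c hc
  refine ⟨fun a ha => ?_, hu, fun a ha h => ?_⟩
  · rcases (hu a ha).eq_or_lt with h | h
    · rw [pairing_add, pairing_smul, ← h, mul_zero, add_zero]
      exact hp a ha h.symm
    · exact (hc a ha h).le
  · by_contra hne
    exact (hc a ha (lt_of_le_of_ne (hu a ha) (Ne.symm hne))).ne' h

end Cones

/-! ### Fans from classes of weights -/

section Fan

variable {n : ℕ}

/-- The functional `v ↦ - v 0`. -/
def negFirst (n : ℕ) : Fin (n + 1) → ℤ := -Pi.single 0 1

@[simp] theorem pairing_negFirst (v : Fin (n + 1) → ℝ) : pairing (negFirst n) v = -v 0 := by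
  rw [negFirst, pairing_neg_left]
  simp [pairing, Fin.sum_univ_succ]

/-- Every face in the boundary hyperplane is the boundary part of a face that meets the open half
space. -/
theorem exists_faceAt_inter_eq {A : Finset (Fin (n + 1) → ℤ)} (hA : negFirst n ∈ A)
    {p z : Fin (n + 1) → ℝ} (hp : p ∈ coneOf A) (hp0 : p 0 < 0) (hz : z ∈ coneOf A)
    (hz0 : z 0 = 0) :
    ∃ v ∈ coneOf A, v 0 < 0 ∧ faceAt A v ∩ {u | u 0 = 0} = faceAt A z := by
  classical
  have hne : {v | v ∈ coneOf A ∧ v 0 < 0 ∧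
      ∀ a ∈ A, pairing a v = 0 → pairing a z = 0}.Nonempty := by
    refine ⟨p + z, fun a ha => ?_, by simpa [hz0] using hp0, fun a ha h => ?_⟩
    · rw [pairing_add]
      exact add_nonneg (hp a ha) (hz a ha)
    · rw [pairing_add] at h
      have := hp a ha
      have := hz a ha
      linarith
  -- Take the smallest face that contains `z` and meets the open half space, as measured by the
  -- number of functionals not vanishing at `v`.
  obtain ⟨v, ⟨hvA, hv0, hvz⟩, hmin⟩ := WellFounded.has_min
    (measure fun v : Fin (n + 1) → ℝ => #{a ∈ A | pairing a v ≠ 0}).wf _ hne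
  refine ⟨v, hvA, hv0, Set.Subset.antisymm ?_ ?_⟩
  · rintro u ⟨hu, hu0⟩
    refine ⟨hu.1, ?_⟩
    by_contra! hcon
    obtain ⟨a₀, ha₀, ha₀z, ha₀u⟩ := hcon
    have hZ : {a ∈ A | pairing a z = 0 ∧ 0 < pairing a u}.Nonempty :=
      ⟨a₀, mem_filter.2 ⟨ha₀, ha₀z, lt_of_le_of_ne (hu.1 a₀ ha₀) (Ne.symm ha₀u)⟩⟩
    obtain ⟨a₁, ha₁, hratio⟩ := Finset.exists_min_image _
      (fun a => pairing a v / pairing a u) hZ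
    obtain ⟨ha₁A, ha₁z, ha₁u⟩ := mem_filter.1 ha₁
    -- Ratio test: subtracting `c • u` from `v` makes `a₁` vanish and keeps the functionals
    -- vanishing at `z` nonnegative. A large multiple of `z` repairs the others. As `u 0 = z 0 = 0`,
    -- the new point stays in the open half space, contradicting minimality.
    set c := pairing a₁ v / pairing a₁ u with hc
    have hev : ∀ᶠ M : ℝ in atTop, ∀ a ∈ A, 0 < pairing a z →
        0 < pairing a (v - c • u + M • z) := by
      rw [Filter.eventually_all_finset]
      intro a ha
      by_cases h : 0 < pairing a z
      · have hT : Tendsto (fun M : ℝ => pairing a (v - c • u) + M * pairing a z) atTop atTop :=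
          tendsto_atTop_add_const_left _ _ (tendsto_id.atTop_mul_const h)
        filter_upwards [hT.eventually_gt_atTop 0] with M hM _
        rwa [pairing_add, pairing_smul]
      · simp [h]
    obtain ⟨M, hM⟩ := hev.exists
    have hval : ∀ a, pairing a (v - c • u + M • z) =
        pairing a v - c * pairing a u + M * pairing a z := by
      intro a
      rw [pairing_add, pairing_sub, pairing_smul, pairing_smul]
    have hzero : pairing a₁ (v - c • u + M • z) = 0 := by
      rw [hval, ha₁z, hc, div_mul_cancel₀ _ ha₁u.ne']
      ring
    refine hmin (v - c • u + M • z) ⟨fun a ha => ?_, ?_, fun a ha h => ?_⟩ ?_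
    · rcases (hz a ha).eq_or_lt with h | h
      · rw [hval, ← h, mul_zero, add_zero]
        rcases (hu.1 a ha).eq_or_lt with h' | h'
        · rw [← h', mul_zero, sub_zero]
          exact hvA a ha
        · have := hratio a (mem_filter.2 ⟨ha, h.symm, h'⟩)
          rw [le_div_iff₀ h'] at this
          linarith
      · exact (hM a ha h).le
    · have hu0' : u 0 = 0 := hu0
      simpa [hu0', hz0] using hv0
    · by_contra hne
      exact (hM a ha (lt_of_le_of_ne (hz a ha) (Ne.symm hne))).ne' h
    · change #{a ∈ A | _} < #{a ∈ A | _}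
      refine Finset.card_lt_card ((Finset.ssubset_iff_of_subset ?_).2 ⟨a₁, ?_, ?_⟩)
      · intro a ha
        obtain ⟨ha, hne⟩ := mem_filter.1 ha
        refine mem_filter.2 ⟨ha, fun h => hne ?_⟩
        rw [hval, h, hu.2 a ha h, hvz a ha h]
        simp
      · exact mem_filter.2 ⟨ha₁A, fun h => ha₁u.ne' (hu.2 a₁ ha₁A h)⟩
      · exact fun h => (mem_filter.1 h).2 hzero
  · intro u hu
    refine ⟨⟨hu.1, fun a ha h => hu.2 a ha (hvz a ha h)⟩, ?_⟩
    have := hu.2 _ hA (by simp [hz0])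
    simpa using this

variable {K : Type*} {A : K → Finset (Fin (n + 1) → ℤ)}
  {E : (Fin (n + 1) → ℝ) → Set (Fin (n + 1) → ℝ)}

/-- For `u 0 < 0` both sides are the closure of the class of `u`. For `u 0 = 0`, the tangent cones
at `u` of the cones through `u` form a finite closed cover of the open half space. Two of them that
meet there give the same face at `u`, and the half space is connected. -/
theorem faceAt_eq_faceAt [Finite K] (hA : ∀ k, negFirst n ∈ A k)
    (hpt : ∀ k, ∃ w ∈ coneOf (A k), w 0 < 0)
    (hcover : ∀ w : Fin (n + 1) → ℝ, w 0 < 0 → ∃ k, w ∈ coneOf (A k))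
    (hcl : ∀ k, ∀ v ∈ coneOf (A k), v 0 < 0 → closure (E v) = faceAt (A k) v)
    {k l : K} {u : Fin (n + 1) → ℝ} (huk : u ∈ coneOf (A k)) (hul : u ∈ coneOf (A l)) :
    faceAt (A k) u = faceAt (A l) u := by
  have hu0 : u 0 ≤ 0 := by simpa using huk _ (hA k)
  rcases hu0.lt_or_eq with hu0 | hu0
  · rw [← hcl k u huk hu0, ← hcl l u hul hu0]
  let V : K → Set (Fin (n + 1) → ℝ) := fun j =>
    {p | ∀ a ∈ A j, pairing a u = 0 → 0 ≤ pairing a p}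
  have hVclosed : ∀ j, IsClosed (V j) := by
    intro j
    have : V j = ⋂ a ∈ A j, {p | pairing a u = 0 → 0 ≤ pairing a p} := by
      ext p
      simp [V]
    rw [this]
    refine isClosed_biInter fun a _ => ?_
    by_cases h : pairing a u = 0
    · simp only [h, true_imp_iff]
      exact isClosed_le continuous_const (continuous_pairing a)
    · simp [h]
  have hVcover : ∀ p : Fin (n + 1) → ℝ, p 0 < 0 → ∃ j, u ∈ coneOf (A j) ∧ p ∈ V j := by
    intro p hp
    -- Along the ray from `p` in direction `u`, one of the finitely many cones recurs for
    -- arbitrarily large `c`; it contains `u`, and its tangent cone at `u` contains `p`.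
    have hfreq : ∃ j, ∃ᶠ c : ℝ in atTop, p + c • u ∈ coneOf (A j) := by
      by_contra! hcon
      obtain ⟨c, hc⟩ := (Filter.eventually_all.2 hcon).exists
      obtain ⟨j, hj⟩ := hcover (p + c • u) (by simpa [hu0] using hp)
      exact hc j hj
    obtain ⟨j, hj⟩ := hfreq
    refine ⟨j, fun a ha => ?_, fun a ha h => ?_⟩
    · by_contra! hneg
      have hT : Tendsto (fun c : ℝ => pairing a p + c * pairing a u) atTop atBot :=
        tendsto_atBot_add_const_left _ _ (tendsto_id.atTop_mul_const_of_neg hneg)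
      obtain ⟨c, hc1, hc2⟩ := (hj.and_eventually (hT.eventually_lt_atBot 0)).exists
      have := hc1 a ha
      rw [pairing_add, pairing_smul] at this
      linarith
    · obtain ⟨c, hc⟩ := hj.exists
      have := hc a ha
      rwa [pairing_add, pairing_smul, h, mul_zero, add_zero] at this
  have hglue : ∀ i j, u ∈ coneOf (A i) → u ∈ coneOf (A j) → ∀ p : Fin (n + 1) → ℝ, p 0 < 0 →
      p ∈ V i → p ∈ V j → faceAt (A i) u = faceAt (A j) u := by
    intro i j hui huj p hp0 hpi hpj
    obtain ⟨c, ⟨hi1, hi2⟩, hj1, hj2⟩ :=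
      ((eventually_mem_coneOf hui hpi).and (eventually_mem_coneOf huj hpj)).exists
    have hq0 : (p + c • u) 0 < 0 := by simpa [hu0] using hp0
    have heq : faceAt (A i) (p + c • u) = faceAt (A j) (p + c • u) := by
      rw [← hcl i _ hi1 hq0, ← hcl j _ hj1 hq0]
    ext v
    rw [mem_faceAt_iff hi2, mem_faceAt_iff hj2, heq]
  have hconn : IsPreconnected {p : Fin (n + 1) → ℝ | p 0 < 0} := by
    refine Convex.isPreconnected ?_
    exact convex_halfSpace_lt (f := fun p : Fin (n + 1) → ℝ => p 0)
      ⟨fun _ _ => rfl, fun _ _ => rfl⟩ 0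
  by_contra hne
  have hclosed : ∀ P : K → Prop, IsClosed (⋃ j ∈ {j | P j}, V j) := fun P =>
    (Set.toFinite _).isClosed_biUnion fun j _ => hVclosed j
  have hmemV : ∀ j, ∀ w ∈ coneOf (A j), w ∈ V j := fun j w hw a ha _ => hw a ha
  obtain ⟨wk, hwk, hwk0⟩ := hpt k
  obtain ⟨wl, hwl, hwl0⟩ := hpt l
  obtain ⟨p, hp0, hp1, hp2⟩ := isPreconnected_closed_iff.1 hconn _ _
    (hclosed fun j => u ∈ coneOf (A j) ∧ faceAt (A j) u = faceAt (A k) u)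
    (hclosed fun j => u ∈ coneOf (A j) ∧ faceAt (A j) u ≠ faceAt (A k) u)
    (by
      intro p hp
      obtain ⟨j, hj, hpj⟩ := hVcover p hp
      by_cases h : faceAt (A j) u = faceAt (A k) u
      · exact Or.inl (Set.mem_biUnion (x := j) ⟨hj, h⟩ hpj)
      · exact Or.inr (Set.mem_biUnion (x := j) ⟨hj, h⟩ hpj))
    ⟨wk, hwk0, Set.mem_biUnion (x := k) ⟨huk, rfl⟩ (hmemV k wk hwk)⟩
    ⟨wl, hwl0, Set.mem_biUnion (x := l) ⟨hul, fun h => hne h.symm⟩ (hmemV l wl hwl)⟩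
  simp only [Set.mem_iUnion] at hp1 hp2
  obtain ⟨i, hi, hpi⟩ := hp1
  obtain ⟨j, hj, hpj⟩ := hp2
  exact hj.2 ((hglue i j hi.1 hj.1 p hp0 hpi hpj).symm.trans hi.2)

/-- If finitely many cones cover the open half space and are subdivided by the classes `E v`
into the relative interiors of their faces, then the closures of the classes and their boundary
parts form a rational polyhedral fan. -/
theorem isRationalPolyhedralFan_of_cover [Finite K] (hA : ∀ k, negFirst n ∈ A k)
    (hpt : ∀ k, ∃ w ∈ coneOf (A k), w 0 < 0)
    (hcover : ∀ w : Fin (n + 1) → ℝ, w 0 < 0 → ∃ k, w ∈ coneOf (A k))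
    (hE : ∀ k, ∀ v ∈ coneOf (A k), v 0 < 0 → E v = {u | ∀ a ∈ A k,
      (pairing a v = 0 → pairing a u = 0) ∧ (0 < pairing a v → 0 < pairing a u)})
    {S : Set (Set (Fin (n + 1) → ℝ))}
    (hS : S = {C | ∃ w : Fin (n + 1) → ℝ, w 0 < 0 ∧ C = closure (E w)} ∪
      {C | ∃ w : Fin (n + 1) → ℝ, w 0 < 0 ∧ C = closure (E w) ∩ {v | v 0 = 0}}) :
    IsRationalPolyhedralFan S ∧ ⋃₀ S = {v | v 0 ≤ 0} := by
  classical
  have hcl : ∀ k, ∀ v ∈ coneOf (A k), v 0 < 0 → closure (E v) = faceAt (A k) v := by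
    intro k v hv hv0
    rw [hE k v hv hv0, closure_relative_interior hv]
  have hneg : ∀ k, ∀ v ∈ coneOf (A k), v 0 ≤ 0 := fun k v hv => by simpa using hv _ (hA k)
  have hS' : ∀ C, C ∈ S ↔ ∃ k, ∃ z ∈ coneOf (A k), faceAt (A k) z = C := by
    intro C
    rw [hS]
    constructor
    · rintro (⟨w, hw, rfl⟩ | ⟨w, hw, rfl⟩)
      · obtain ⟨k, hk⟩ := hcover w hw
        exact ⟨k, w, hk, (hcl k w hk hw).symm⟩
      · obtain ⟨k, hk⟩ := hcover w hw
        rw [hcl k w hk hw]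
        refine ⟨k, exists_faceAt_eq_of_isFace (z := w)
          ⟨fun i => (negFirst n i : ℝ), fun v hv => hv.1 _ (hA k), ?_⟩⟩
        ext v
        change _ ∧ _ ↔ _ ∧ pairing (negFirst n) v = 0
        simp
    · rintro ⟨k, z, hz, rfl⟩
      rcases (hneg k z hz).lt_or_eq with hz0 | hz0
      · exact Or.inl ⟨z, hz0, (hcl k z hz hz0).symm⟩
      · obtain ⟨p, hp, hp0⟩ := hpt k
        obtain ⟨v, hv, hv0, h⟩ := exists_faceAt_inter_eq (hA k) hp hp0 hz hz0
        exact Or.inr ⟨v, hv0, by rw [hcl k v hv hv0, h]⟩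
  have hface : ∀ {k l : K} {u : Fin (n + 1) → ℝ}, u ∈ coneOf (A k) → u ∈ coneOf (A l) →
      faceAt (A k) u = faceAt (A l) u := fun hk hl => faceAt_eq_faceAt hA hpt hcover hcl hk hl
  refine ⟨⟨?_, ?_, ?_, ?_⟩, ?_⟩
  · have hfin : (⋃ k, (fun B : Finset (Fin (n + 1) → ℤ) =>
        {u | u ∈ coneOf (A k) ∧ ∀ a ∈ B, pairing a u = 0}) '' ((A k).powerset : Set _)).Finite :=
      Set.finite_iUnion fun k => ((A k).powerset.finite_toSet).image _
    refine hfin.subset fun C hC => ?_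
    obtain ⟨k, z, hz, rfl⟩ := (hS' C).1 hC
    refine Set.mem_iUnion.2 ⟨k, {a ∈ A k | pairing a z = 0},
      mem_coe.2 (mem_powerset.2 (filter_subset _ _)), ?_⟩
    ext u
    simp only [faceAt, Set.mem_ofPred_eq, mem_filter, and_imp]
  · intro C hC
    obtain ⟨k, z, hz, rfl⟩ := (hS' C).1 hC
    exact isRationalPolyhedralCone_faceAt
  · intro C hC F hF
    obtain ⟨k, z, hz, rfl⟩ := (hS' C).1 hC
    obtain ⟨u, hu, rfl⟩ := exists_faceAt_eq_of_isFace hF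
    exact (hS' _).2 ⟨k, u, hu, rfl⟩
  · intro C hC D hD
    obtain ⟨k, z, hz, rfl⟩ := (hS' C).1 hC
    obtain ⟨l, y, hy, rfl⟩ := (hS' D).1 hD
    -- The intersection is the smallest face at a relative interior point `u`, and `hface` makes
    -- that face the same in both cones.
    obtain ⟨u, hu, hmin⟩ := exists_relative_interior (A := A k ∪ A l)
      (D := faceAt (A k) z ∩ faceAt (A l) y)
      (fun v hv a ha => (mem_union.1 ha).elim (hv.1.1 a) (hv.2.1 a))
      ⟨zero_mem_faceAt, zero_mem_faceAt⟩
      fun u hu v hv => ⟨add_mem_faceAt hu.1 hv.1, add_mem_faceAt hu.2 hv.2⟩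
    have hkl := hface hu.1.1 hu.2.1
    have heq : faceAt (A k) z ∩ faceAt (A l) y = faceAt (A k) u := by
      refine Set.Subset.antisymm (fun v hv => ⟨hv.1.1, fun a ha => hmin v hv a
        (mem_union_left _ ha)⟩) fun v hv => ⟨faceAt_subset hu.1 hv, ?_⟩
      rw [hkl] at hv
      exact faceAt_subset hu.2 hv
    refine ⟨heq ▸ isFace_faceAt hu.1, ?_⟩
    rw [heq, hkl]
    exact isFace_faceAt hu.2
  · ext u
    simp only [Set.mem_sUnion, Set.mem_ofPred_eq]
    constructor
    · rintro ⟨C, hC, hu⟩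
      obtain ⟨k, z, hz, rfl⟩ := (hS' C).1 hC
      exact hneg k u hu.1
    · intro hu
      suffices ∃ k, u ∈ coneOf (A k) by
        obtain ⟨k, hk⟩ := this
        exact ⟨_, (hS' _).2 ⟨k, u, hk, rfl⟩, mem_faceAt_self hk⟩
      have hclosed : IsClosed (⋃ k, coneOf (A k)) := by
        refine isClosed_iUnion_of_finite fun k => ?_
        have : coneOf (A k) = ⋂ a ∈ A k, {v | 0 ≤ pairing a v} := by
          ext v
          simp [coneOf]
        rw [this]
        exact isClosed_biInter fun a _ => isClosed_le continuous_const (continuous_pairing a)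
      have hlim : Tendsto (fun ε : ℝ => u - ε • Pi.single 0 1) (𝓝[>] 0) (𝓝 u) := by
        have : Tendsto (fun ε : ℝ => u - ε • Pi.single 0 1) (𝓝 0)
            (𝓝 (u - (0 : ℝ) • Pi.single 0 1)) := Continuous.tendsto (by fun_prop) 0
        rw [zero_smul, sub_zero] at this
        exact this.mono_left nhdsWithin_le_nhds
      refine Set.mem_iUnion.1 (hclosed.mem_of_tendsto hlim ?_)
      filter_upwards [self_mem_nhdsWithin] with ε hε
      refine Set.mem_iUnion.2 (hcover _ ?_)
      have : (0 : ℝ) < ε := hε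
      simp
      linarith

end Fan

end GroebnerFan

/-! ### The cone of a reduced basis and the conclusion -/

namespace GroebnerFan

variable {R : Type*} [CommRing R] {n : ℕ}

/-- The difference of two exponents as an integral functional on weights. -/
def exponentSub (e e' : Fin (n + 1) →₀ ℕ) : Fin (n + 1) → ℤ := fun i => (e i : ℤ) - e' i

@[simp] theorem pairing_exponentSub (e e' : Fin (n + 1) →₀ ℕ) (v : Fin (n + 1) → ℝ) :
    pairing (exponentSub e e') v = weight v e - weight v e' := by
  simp only [pairing, exponentSub, weight, ← Finset.sum_sub_distrib]
  refine Finset.sum_congr rfl fun i _ => ?_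
  push_cast
  ring

open Classical in
/-- The functionals that describe the weights for which `m i` has maximal weight in `g i`. -/
noncomputable def leadFunctionals {ι : Type*} [Fintype ι] (g : ι → MixedRing R n)
    (m : ι → Fin (n + 1) →₀ ℕ) : Finset (Fin (n + 1) → ℤ) :=
  insert (negFirst n) (Finset.univ.biUnion fun i =>
    (finite_minimalSupport (g i)).toFinset.image fun e => exponentSub (m i) e)

theorem mem_leadFunctionals {ι : Type*} [Fintype ι] {g : ι → MixedRing R n}
    {m : ι → Fin (n + 1) →₀ ℕ} {a : Fin (n + 1) → ℤ} : a ∈ leadFunctionals g m ↔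
      a = negFirst n ∨ ∃ i, ∃ e ∈ minimalSupport (g i), exponentSub (m i) e = a := by
  classical
  simp [leadFunctionals]

theorem mem_coneOf_leadFunctionals {ι : Type*} [Fintype ι] {g : ι → MixedRing R n}
    {m : ι → Fin (n + 1) →₀ ℕ} {v : Fin (n + 1) → ℝ} (hv : v 0 < 0) :
    v ∈ coneOf (leadFunctionals g m) ↔
      ∀ i, ∀ e ∈ termSupport (g i), weight v e ≤ weight v (m i) := by
  constructor
  · intro h i e he
    obtain ⟨e', he', hlt⟩ := exists_mem_minimalSupport he
    have h1 := h _ (mem_leadFunctionals.2 (Or.inr ⟨i, e', he', rfl⟩))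
    rw [pairing_exponentSub] at h1
    rcases hlt v hv with rfl | h2 <;> linarith
  · intro h a ha
    rcases mem_leadFunctionals.1 ha with rfl | ⟨i, e, he, rfl⟩
    · simpa using hv.le
    · simpa using h i e he.1

/-- Equality of initial supports says that the same exponents tie with `m i`; testing this on the
minimal exponents suffices, since no other can tie. `negFirst` records `u 0 < 0`. -/
theorem IsReducedBasis.class_eq {Γ : Type*} [AddCommMonoid Γ] [LinearOrder Γ]
    [IsOrderedCancelAddMonoid Γ] {κ : (Fin (n + 1) →₀ ℕ) →+ Γ} {w : Fin (n + 1) → ℝ}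
    (hw : w 0 < 0) (hκ : Refines κ w) {I : Ideal (MixedRing R n)}
    (hI : HasXComponents I) {ι : Type*} [Fintype ι] {g : ι → MixedRing R n}
    {m : ι → Fin (n + 1) →₀ ℕ} (h : IsReducedBasis κ I g m) {v : Fin (n + 1) → ℝ}
    (hv : v ∈ coneOf (leadFunctionals g m)) (hv0 : v 0 < 0) :
    {u | u 0 < 0 ∧ initialIdeal u I = initialIdeal v I} = {u | ∀ a ∈ leadFunctionals g m,
      (pairing a v = 0 → pairing a u = 0) ∧ (0 < pairing a v → 0 < pairing a u)} := by
  have hvm := (mem_coneOf_leadFunctionals hv0).1 hv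
  have hmem : ∀ u : Fin (n + 1) → ℝ,
      (∀ i, ∀ e ∈ termSupport (g i), weight u e ≤ weight u (m i)) → ∀ i e,
      e ∈ initialSupport u (g i) ↔ e ∈ termSupport (g i) ∧ weight u e = weight u (m i) := by
    intro u hu i e
    exact ⟨fun he => ⟨he.1, le_antisymm (hu i e he.1) (he.2 _ (h.lead i).1)⟩,
      fun he => ⟨he.1, fun e' he' => he.2 ▸ hu i e' he'⟩⟩
  ext u
  constructor
  · rintro ⟨hu0, hu⟩ a ha
    rw [h.initialIdeal_eq_iff hw hκ hI hv0 hvm hu0] at hu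
    rcases mem_leadFunctionals.1 ha with rfl | ⟨i, e, he, rfl⟩
    · exact ⟨fun h0 => absurd h0 (by simpa using hv0.ne), fun _ => by simpa using hu0⟩
    · have hm : m i ∈ initialSupport u (g i) := by
        rw [hu i, hmem v hvm]
        exact ⟨(h.lead i).1, rfl⟩
      have he' : e ∈ initialSupport u (g i) ↔ e ∈ initialSupport v (g i) := by rw [hu i]
      rw [hmem v hvm] at he'
      simp only [pairing_exponentSub, sub_eq_zero, sub_pos]
      refine ⟨fun h0 => ?_, fun hlt => ?_⟩
      · have := (he'.2 ⟨he.1, h0.symm⟩).2 _ hm.1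
        exact le_antisymm this (hm.2 e he.1)
      · refine lt_of_le_of_ne (hm.2 e he.1) fun h0 => ?_
        exact hlt.ne (he'.1 ⟨he.1, fun e' h' => h0 ▸ hm.2 e' h'⟩).2
  · intro hu
    have hu0 : u 0 < 0 := by
      have := (hu _ (mem_leadFunctionals.2 (Or.inl rfl))).2 (by simpa using hv0)
      simpa using this
    have huA : u ∈ coneOf (leadFunctionals g m) := fun a ha =>
      (hv a ha).eq_or_lt.elim (fun h0 => ((hu a ha).1 h0.symm).ge) fun h0 => ((hu a ha).2 h0).le
    have hum := (mem_coneOf_leadFunctionals hu0).1 huA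
    refine ⟨hu0, (h.initialIdeal_eq_iff hw hκ hI hv0 hvm hu0).2 fun i => ?_⟩
    ext e
    rw [hmem v hvm, hmem u hum]
    refine and_congr_right fun he => ?_
    obtain ⟨e', he', hlt⟩ := exists_mem_minimalSupport he
    have ha := hu _ (mem_leadFunctionals.2 (Or.inr ⟨i, e', he', rfl⟩))
    simp only [pairing_exponentSub] at ha
    have hue := hum i e' he'.1
    have hve := hvm i e' he'.1
    constructor
    · intro h0
      obtain rfl := (hlt u hu0).resolve_right (by linarith)
      by_contra hne
      have := ha.2 (sub_pos.2 (lt_of_le_of_ne hve hne))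
      linarith
    · intro h0
      obtain rfl := (hlt v hv0).resolve_right (by linarith)
      linarith [ha.1 (by linarith)]

end GroebnerFan

open GroebnerFan in
theorem theorem3p16 {R : Type*} [CommRing R] [IsNoetherianRing R] (n : ℕ)
    (I : Ideal (GroebnerFan.MixedRing R n)) (hI : GroebnerFan.IsXHomogeneous I) :
    GroebnerFan.IsRationalPolyhedralFan (GroebnerFan.groebnerFan I) ∧
      ⋃₀ GroebnerFan.groebnerFan I = {v : Fin (n + 1) → ℝ | v 0 ≤ 0} := by
  have hI' := hI.hasXComponents
  have hinj := lexOrder_injective n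
  have hfin := finite_leadIdeals hinj I
  -- One cone for each leading ideal that occurs, from a reduced basis for a chosen weight.
  let K := {L // ∃ w : Fin (n + 1) → ℝ, w 0 < 0 ∧ leadIdeal (weightOrder w (lexOrder n)) I = L}
  have : Finite K := hfin
  choose w hw hL using fun L : K => L.2
  choose k g m hgm using fun L : K =>
    exists_isReducedBasis (hw L) (refines_weightOrder (w L) hinj) I
  refine isRationalPolyhedralFan_of_cover (K := K) (A := fun L => leadFunctionals (g L) (m L))
    (E := fun v => {u | u 0 < 0 ∧ initialIdeal u I = initialIdeal v I})
    (fun L => mem_leadFunctionals.2 (Or.inl rfl)) (fun L => ⟨w L, ?_, hw L⟩) (fun v hv => ?_)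
    (fun L v hv hv0 =>
      (hgm L).class_eq (hw L) (refines_weightOrder (w L) hinj) hI' hv hv0) rfl
  · exact (mem_coneOf_leadFunctionals (hw L)).2 fun i e he =>
      (refines_weightOrder (w L) hinj).weight_le (((hgm L).lead i).2 e he)
  · obtain ⟨L, hLv⟩ : ∃ L : K, (L : Ideal _) = leadIdeal (weightOrder v (lexOrder n)) I :=
      ⟨⟨_, v, hv, rfl⟩, rfl⟩
    refine ⟨L, (mem_coneOf_leadFunctionals hv).2 fun i e he => ?_⟩
    have hne : g L i ≠ 0 := fun h0 => ((hgm L).lead i).1 (by simp [h0])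
    obtain ⟨s, hs⟩ := exists_isLead hv (refines_weightOrder v hinj) hne
    -- The `v`-leading term of `g L i` lies in the leading ideal shared by `v` and `w L`; by
    -- reducedness its exponent is `m L i`.
    have hsm : s = m L i := (hgm L).reduced i s hs.1 <| by
      rw [hL L, hLv]
      exact monomial_mem_leadIdeal hI' ((hgm L).mem i) hs
    rw [← hsm]
    exact (refines_weightOrder v hinj).weight_le (hs.2 e he)
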